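/- Let $(M,g)$ be a smooth, oriented and time-oriented four-dimensional spacetime of signature $(-,+,+,+)$ with volume element $\eta$, Ricci tensor $\mathrm{Ric}$ and $r=\mathrm{tr}\,\mathrm{Ric}$, and put $2Q=\mathrm{Ric}-\frac r6 g$. Write $(\cdot,\cdot)$ for $g$ and for the induced metric $(F,K)=\frac12F_{\alpha\beta}K^{\alpha\beta}$ on (real or complex) 2-forms, $B(x)_\alpha=B_{\alpha\beta}x^\beta$, $(T\cdot x)_{\dots}=T_{\dots\alpha}x^\alpha$, $u\wedge v=u\otimes v-v\otimes u$, $u\,\tilde\otimes\,v=u\otimes v+v\otimes u$, $(\nabla T)_{\alpha\beta\dots}=\nabla_\alpha T_{\beta\dots}$; indices are raised and lowered with $g$. Suppose the Weyl tensor $W$ is of type N on an open set $\Omega\subseteq M$, i.e. $W\neq0$ and $\mathcal W^2=0$ at every point of $\Omega$, where $\mathcal W=\frac12(W-\mathrm i*W)$ and $(\mathcal W^2)_{\alpha\beta\mu\nu}=\frac12\mathcal W_{\alpha\beta\lambda\rho}\mathcal W^{\lambda\rho}{}_{\mu\nu}$. Let $L$ be a smooth fundamental 2-form on $\Omega$ (determined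 up to sign): $\mathcal W=\mathcal L\otimes\mathcal L$ with $\mathcal L=\frac1{\sqrt2}(L-\mathrm i*L)$; and let $\ell$ be the fundamental vector, the future-pointing null vector with $L=\ell\wedge e_2$ for some unit spacelike $e_2$ orthogonal to $\ell$. With an arbitrary smooth timelike vector field $x$ on $\Omega$ define $$a=-\tfrac1{(\ell,x)}(\nabla L\cdot\ell)(x),\quad a^*=\tfrac1{(\ell,x)}(\nabla{*L}\cdot\ell)(x),\quad \alpha=\tfrac{(a,x)}{(\ell,x)},\quad \alpha^*=\tfrac{(a^*,x)}{(\ell,x)},$$ $$B=\nabla\ell+{}^t\nabla\ell,\qquad b=\tfrac1{(\ell,x)}\Big[B(x)-\tfrac{B(x,x)}{2(\ell,x)}\,\ell\Big],$$ $$C_{\alpha\beta\gamma}=\nabla_{(\alpha}{*L}_{\beta}{}^{\mu}L_{\gamma)\mu},\qquad c=\tfrac1{(\ell,x)^3}\big[3(\ell,x)\,C(x,x)-2\,C(x,x,x)\,\ell\big].$$ The spacetime region $\Omega$ belongs to the family $\widehat{\mathrm C5}$ if on $\Omega$ $$(\nabla_\ell\mathcal L,\nabla_\ell\mathcal L)=0,\quad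 |(\nabla_a\mathcal L,\nabla_a\mathcal L)|+|(\nabla_{a^*}\mathcal L,\nabla_{a^*}\mathcal L)|=0,\quad (\mathrm d\ell,\mathrm d\ell)=0,\quad (\ell\wedge c,\ell\wedge c)=0,\quad (\mathrm db,\mathrm db)=0 .$$ **Proposition.** If $\Omega$ belongs to the family $\widehat{\mathrm C5}$, then at every point of $\Omega$ the vector $\ell$ is an eigenvector, $Q(\ell)=\lambda\ell$ with $\lambda=Q(\ell,x)/(\ell,x)$, and $$2\lambda+\alpha^2+\alpha^{*2}=0,\qquad \lambda\le0 ,$$ with $\lambda=0$ if and only if $\alpha=\alpha^*=0$. Moreover, if $\lambda$ vanishes identically on an open subset $V\subseteq\Omega$ contained in a coordinate chart, then there is a smooth vector field $q$ on $V$ with $Q=\ell\,\tilde\otimes\,q$ and $(\ell,q)=0$. In that case $q^2=(q,q)\ge0$, and at each point of $V$: (i) $Q=0$ and $\mathrm{Ric}=0$ (vacuum) if $q=0$; (ii) the Ricci tensor is of Segre type $[(211)]$ if $q\ne0$ and $q^2=0$; (iii) the Ricci tensor is of Segre type $[(31)]$ if $q^2>0$. (A linear operator is of Segre type $[(n_1\cdots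 n_m)]$ if it has a single, real eigenvalue and its Jordan blocks have sizes $n_1,\dots,n_m$.) -/

import Mathlib

open scoped Manifold ContDiff

noncomputable section

namespace TypeN

/-- The model space of coordinates of a four-dimensional spacetime. -/
abbrev Pt : Type := EuclideanSpace ℝ (Fin 4)

/-! ### Tensor algebra in components

All tensors are given by their covariant components; `h` is the matrix of the inverse metric,
which raises indices. -/

/-- `v^i = h^{ij} v_j`. -/
def raise (h : Matrix (Fin 4) (Fin 4) ℝ) (v : Fin 4 → ℝ) (i : Fin 4) : ℝ :=
  ∑ j, h i j * v j

/-- `(v, w) = h^{ij} v_i w_j`. -/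
def ip (h : Matrix (Fin 4) (Fin 4) ℝ) (v w : Fin 4 → ℝ) : ℝ :=
  ∑ i, v i * raise h w i

/-- `B(x)_i = B_{ij} x^j`. -/
def app (h : Matrix (Fin 4) (Fin 4) ℝ) (B : Fin 4 → Fin 4 → ℝ) (x : Fin 4 → ℝ) (i : Fin 4) : ℝ :=
  ∑ j, B i j * raise h x j

/-- `B(x, y) = B_{ij} x^i y^j`. -/
def app₂ (h : Matrix (Fin 4) (Fin 4) ℝ) (B : Fin 4 → Fin 4 → ℝ) (x y : Fin 4 → ℝ) : ℝ :=
  ∑ i, raise h x i * app h B y i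

/-- `(v ∧ w)_{ij} = v_i w_j - w_i v_j`. -/
def wedge (v w : Fin 4 → ℝ) (i j : Fin 4) : ℝ := v i * w j - w i * v j

/-- The symmetrized product `v_i w_j + w_i v_j`. -/
def symProd (v w : Fin 4 → ℝ) (i j : Fin 4) : ℝ := v i * w j + w i * v j

/-- The metric on (real) 2-forms, `(F, K) = (1/2) F_{ij} K^{ij}`. -/
def ipForm (h : Matrix (Fin 4) (Fin 4) ℝ) (F K : Fin 4 → Fin 4 → ℝ) : ℝ :=
  (1 / 2) * ∑ i, ∑ j, ∑ k, ∑ l, h i k * h j l * F i j * K k l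

/-- The complex bilinear extension of `ipForm` to complex 2-forms. -/
def ipBiv (h : Matrix (Fin 4) (Fin 4) ℝ) (F K : Fin 4 → Fin 4 → ℂ) : ℂ :=
  (1 / 2) * ∑ i, ∑ j, ∑ k, ∑ l, (h i k : ℂ) * (h j l : ℂ) * F i j * K k l

/-- The Hodge dual `(*F)_{ij} = (1/2) η_{ijkl} F^{kl}` for the volume form `η`. -/
def hodge (h : Matrix (Fin 4) (Fin 4) ℝ) (η : Fin 4 → Fin 4 → Fin 4 → Fin 4 → ℝ)
    (F : Fin 4 → Fin 4 → ℝ) (i j : Fin 4) : ℝ :=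
  (1 / 2) * ∑ k, ∑ l, ∑ m, ∑ n, η i j k l * h k m * h l n * F m n

/-- The self-dual bivector `(F - i S)/√2`, where `S` is the Hodge dual of `F`. -/
def bivector (F S : Fin 4 → Fin 4 → ℝ) (i j : Fin 4) : ℂ :=
  ((F i j : ℂ) - Complex.I * (S i j : ℂ)) / (Real.sqrt 2 : ℂ)

/-! ### Differential geometry of a metric in a coordinate domain -/

/-- The partial derivative `∂_i f`. -/
def pd (i : Fin 4) (f : Pt → ℝ) (y : Pt) : ℝ := fderiv ℝ f y (EuclideanSpace.single i 1)

section Metric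

variable (g : Pt → Fin 4 → Fin 4 → ℝ)

/-- The inverse metric `g^{ij}`. -/
def gInv (y : Pt) : Matrix (Fin 4) (Fin 4) ℝ := (Matrix.of (g y))⁻¹

/-- Christoffel symbols `Γ^k_{ij}` of the Levi-Civita connection. -/
def christoffel (k i j : Fin 4) (y : Pt) : ℝ :=
  (1 / 2) * ∑ m, gInv g y k m *
    (pd i (fun z ↦ g z m j) y + pd j (fun z ↦ g z m i) y - pd m (fun z ↦ g z i j) y)

/-- `∇_i v_j`. -/
def cov₁ (v : Pt → Fin 4 → ℝ) (y : Pt) (i j : Fin 4) : ℝ :=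
  pd i (fun z ↦ v z j) y - ∑ m, christoffel g m i j y * v y m

/-- `∇_i T_{jk}`. -/
def cov₂ (T : Pt → Fin 4 → Fin 4 → ℝ) (y : Pt) (i j k : Fin 4) : ℝ :=
  pd i (fun z ↦ T z j k) y - ∑ m, christoffel g m i j y * T y m k
    - ∑ m, christoffel g m i k y * T y j m

/-- The exterior derivative `∂_i v_j - ∂_j v_i` of a 1-form. -/
def extD (v : Pt → Fin 4 → ℝ) (y : Pt) (i j : Fin 4) : ℝ :=
  pd i (fun z ↦ v z j) y - pd j (fun z ↦ v z i) y

/-- The curvature tensor `R^a_{bcd}`, with the sign for which round spheres have positive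
Ricci tensor `R_{bd} = R^a_{bad}`. -/
def riemannUp (y : Pt) (a b c d : Fin 4) : ℝ :=
  pd c (christoffel g a d b) y - pd d (christoffel g a c b) y
    + ∑ e, christoffel g a c e y * christoffel g e d b y
    - ∑ e, christoffel g a d e y * christoffel g e c b y

/-- `R_{abcd}`. -/
def riemann (y : Pt) (a b c d : Fin 4) : ℝ := ∑ e, g y a e * riemannUp g y e b c d

/-- The Ricci tensor. -/
def ricci (y : Pt) (b d : Fin 4) : ℝ := ∑ a, riemannUp g y a b a d

/-- The trace `r` of the Ricci tensor. -/
def scalarCurv (y : Pt) : ℝ := ∑ i, ∑ j, gInv g y i j * ricci g y i j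

/-- The tensor `Q` with `2 Q = Ric - (r/6) g`. -/
def Q (y : Pt) (i j : Fin 4) : ℝ := (1 / 2) * (ricci g y i j - scalarCurv g y / 6 * g y i j)

/-- The Weyl tensor `W_{abcd}`. -/
def weyl (y : Pt) (a b c d : Fin 4) : ℝ :=
  riemann g y a b c d
    - (g y a c * Q g y b d - g y a d * Q g y b c + g y b d * Q g y a c - g y b c * Q g y a d)

/-- The self-dual Weyl tensor `(1/2)(W - i *W)`, where `*` acts on the first pair of indices. -/
def weylSD (η : Pt → Fin 4 → Fin 4 → Fin 4 → Fin 4 → ℝ) (y : Pt) (a b c d : Fin 4) : ℂ :=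
  (1 / 2) * ((weyl g y a b c d : ℂ) -
    Complex.I * (hodge (gInv g y) (η y) (fun i j ↦ weyl g y i j c d) a b : ℂ))

/-- The square `(𝓦²)_{abcd} = (1/2) 𝓦_{abij} 𝓦^{ij}_{cd}` of the self-dual Weyl tensor. -/
def weylSDSq (η : Pt → Fin 4 → Fin 4 → Fin 4 → Fin 4 → ℝ) (y : Pt) (a b c d : Fin 4) : ℂ :=
  (1 / 2) * ∑ i, ∑ j, ∑ k, ∑ l, weylSD g η y a b i j *
    (gInv g y i k : ℂ) * (gInv g y j l : ℂ) * weylSD g η y k l c d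

/-- The Ricci operator `v^i ↦ R^i_j v^j`. -/
def ricciOp (y : Pt) : (Fin 4 → ℝ) →ₗ[ℝ] (Fin 4 → ℝ) :=
  Matrix.toLin' (gInv g y * Matrix.of (ricci g y))

end Metric

/-- The operator `A` has Segre type `[(n₁ n₂ … n_m)]`: it has a single eigenvalue, which is real,
and in a suitable basis it is the direct sum of Jordan blocks of sizes `n₁, …, n_m`. -/
def HasSegreType {V : Type*} [AddCommGroup V] [Module ℝ V] (A : V →ₗ[ℝ] V)
    {m : ℕ} (n : Fin m → ℕ) : Prop :=
  ∃ (μ : ℝ) (b : Module.Basis (Σ j : Fin m, Fin (n j)) ℝ V), ∀ (j : Fin m) (k : Fin (n j)),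
    A (b ⟨j, k⟩) = μ • b ⟨j, k⟩ +
      (if 0 < k.val then b ⟨j, ⟨k.val - 1, lt_of_le_of_lt (Nat.sub_le _ _) k.isLt⟩⟩ else 0)

/-! ### Concomitants of a type N Weyl tensor -/

/-- Covariant components, in a coordinate domain, of the metric, of the volume form, of the
fundamental 2-form `L`, of the fundamental vector `ℓ` and of an auxiliary timelike vector
field `x`. -/
structure Fields where
  g : Pt → Fin 4 → Fin 4 → ℝ
  η : Pt → Fin 4 → Fin 4 → Fin 4 → Fin 4 → ℝ
  L : Pt → Fin 4 → Fin 4 → ℝ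
  ℓ : Pt → Fin 4 → ℝ
  x : Pt → Fin 4 → ℝ

namespace Fields

variable (D : Fields)

/-- The inverse metric. -/
def inv (y : Pt) : Matrix (Fin 4) (Fin 4) ℝ := gInv D.g y

/-- `(ℓ, x)`. -/
def lx (y : Pt) : ℝ := ip (D.inv y) (D.ℓ y) (D.x y)

/-- The dual 2-form `*L`. -/
def starL (y : Pt) : Fin 4 → Fin 4 → ℝ := hodge (D.inv y) (D.η y) (D.L y)

/-- The fundamental bivector `𝓛 = (L - i *L)/√2`. -/
def bivL (y : Pt) : Fin 4 → Fin 4 → ℂ := bivector (D.L y) (D.starL y)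

/-- The covariant derivative `∇_v 𝓛` along (the vector equivalent to) `v`. -/
def covBivL (v : Fin 4 → ℝ) (y : Pt) : Fin 4 → Fin 4 → ℂ :=
  bivector (fun j k ↦ ∑ i, raise (D.inv y) v i * cov₂ D.g D.L y i j k)
    (fun j k ↦ ∑ i, raise (D.inv y) v i * cov₂ D.g D.starL y i j k)

/-- `a = -(1/(ℓ,x)) (∇L·ℓ)(x)`. -/
def a (y : Pt) (i : Fin 4) : ℝ :=
  -(1 / D.lx y) * app (D.inv y) (fun i j ↦ app (D.inv y) (cov₂ D.g D.L y i) (D.ℓ y) j) (D.x y) i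

/-- `a* = (1/(ℓ,x)) (∇*L·ℓ)(x)`. -/
def aStar (y : Pt) (i : Fin 4) : ℝ :=
  (1 / D.lx y) *
    app (D.inv y) (fun i j ↦ app (D.inv y) (cov₂ D.g D.starL y i) (D.ℓ y) j) (D.x y) i

/-- `α = (a,x)/(ℓ,x)`. -/
def alpha (y : Pt) : ℝ := ip (D.inv y) (D.a y) (D.x y) / D.lx y

/-- `α* = (a*,x)/(ℓ,x)`. -/
def alphaStar (y : Pt) : ℝ := ip (D.inv y) (D.aStar y) (D.x y) / D.lx y

/-- `B = ∇ℓ + ᵗ∇ℓ`. -/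
def B (y : Pt) (i j : Fin 4) : ℝ := cov₁ D.g D.ℓ y i j + cov₁ D.g D.ℓ y j i

/-- `b = (1/(ℓ,x)) [B(x) - (B(x,x) / (2(ℓ,x))) ℓ]`. -/
def b (y : Pt) (i : Fin 4) : ℝ :=
  (1 / D.lx y) * (app (D.inv y) (D.B y) (D.x y) i
    - app₂ (D.inv y) (D.B y) (D.x y) (D.x y) / (2 * D.lx y) * D.ℓ y i)

/-- `∇_i (*L)_j^m L_{km}`. -/
def preC (y : Pt) (i j k : Fin 4) : ℝ :=
  ∑ m, ∑ n, cov₂ D.g D.starL y i j m * D.inv y m n * D.L y k n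

/-- The tensor `C`, the total symmetrization of `∇_i (*L)_j^m L_{km}`. -/
def C (y : Pt) (i j k : Fin 4) : ℝ :=
  (1 / 6) * (D.preC y i j k + D.preC y i k j + D.preC y j i k + D.preC y j k i
    + D.preC y k i j + D.preC y k j i)

/-- `C(x,x)_i`. -/
def Cxx (y : Pt) (i : Fin 4) : ℝ := app₂ (D.inv y) (D.C y i) (D.x y) (D.x y)

/-- `C(x,x,x)`. -/
def Cxxx (y : Pt) : ℝ := ip (D.inv y) (D.Cxx y) (D.x y)

/-- `c = (1/(ℓ,x)³) [3 (ℓ,x) C(x,x) - 2 C(x,x,x) ℓ]`. -/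
def c (y : Pt) (i : Fin 4) : ℝ :=
  (1 / D.lx y ^ 3) * (3 * D.lx y * D.Cxx y i - 2 * D.Cxxx y * D.ℓ y i)

/-- `φ₁ = (𝓕₁, 𝓕₁)` with `𝓕₁ = ∇_ℓ 𝓛`. -/
def phi1 (y : Pt) : ℂ := ipBiv (D.inv y) (D.covBivL (D.ℓ y) y) (D.covBivL (D.ℓ y) y)

/-- `φ₂ = |(𝓕₂, 𝓕₂)| + |(𝓕₂*, 𝓕₂*)|` with `𝓕₂ = ∇_a 𝓛` and `𝓕₂* = ∇_{a*} 𝓛`. -/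
def phi2 (y : Pt) : ℝ :=
  ‖ipBiv (D.inv y) (D.covBivL (D.a y) y) (D.covBivL (D.a y) y)‖
    + ‖ipBiv (D.inv y) (D.covBivL (D.aStar y) y) (D.covBivL (D.aStar y) y)‖

/-- `φ₃ = (dℓ, dℓ)`. -/
def phi3 (y : Pt) : ℝ := ipForm (D.inv y) (extD D.ℓ y) (extD D.ℓ y)

/-- `φ₄ = (ℓ ∧ c, ℓ ∧ c)`. -/
def phi4 (y : Pt) : ℝ := ipForm (D.inv y) (wedge (D.ℓ y) (D.c y)) (wedge (D.ℓ y) (D.c y))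

/-- `φ₅ = (db, db)`. -/
def phi5 (y : Pt) : ℝ := ipForm (D.inv y) (extD D.b y) (extD D.b y)

/-- `λ = Q(ℓ,x)/(ℓ,x)`. -/
def lam (y : Pt) : ℝ := app₂ (D.inv y) (Q D.g y) (D.ℓ y) (D.x y) / D.lx y

end Fields

/-! ### Spacetimes -/

section Manifold

variable {M : Type*} [TopologicalSpace M] [ChartedSpace Pt M]

/-- The smooth charts of `M`. -/
def charts (M : Type*) [TopologicalSpace M] [ChartedSpace Pt M] : Set (OpenPartialHomeomorph M Pt) :=
  IsManifold.maximalAtlas 𝓘(ℝ, Pt) ∞ M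

/-- The coordinate vector `∂_i` of the chart `e` at the point with coordinates `y`. -/
def coordVec (e : OpenPartialHomeomorph M Pt) (y : Pt) (i : Fin 4) :
    TangentSpace 𝓘(ℝ, Pt) (e.symm y) :=
  mfderiv 𝓘(ℝ, Pt) 𝓘(ℝ, Pt) e.symm y (EuclideanSpace.single i (1 : ℝ) : Pt)

/-- Components of a covariant 2-tensor field in the chart `e`. -/
def comp₂ (T : ∀ p : M, LinearMap.BilinForm ℝ (TangentSpace 𝓘(ℝ, Pt) p))
    (e : OpenPartialHomeomorph M Pt) (y : Pt) (i j : Fin 4) : ℝ :=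
  T (e.symm y) (coordVec e y i) (coordVec e y j)

/-- Covariant components `g(X, ∂_i)` of a vector field `X` in the chart `e`. -/
def comp₁ (g : ∀ p : M, LinearMap.BilinForm ℝ (TangentSpace 𝓘(ℝ, Pt) p))
    (X : ∀ p : M, TangentSpace 𝓘(ℝ, Pt) p)
    (e : OpenPartialHomeomorph M Pt) (y : Pt) (i : Fin 4) : ℝ :=
  g (e.symm y) (X (e.symm y)) (coordVec e y i)

/-- Components of a 4-form in the chart `e`. -/
def comp₄ (η : ∀ p : M, (TangentSpace 𝓘(ℝ, Pt) p) [⋀^Fin 4]→ₗ[ℝ] ℝ)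
    (e : OpenPartialHomeomorph M Pt) (y : Pt) (i j k l : Fin 4) : ℝ :=
  η (e.symm y) ![coordVec e y i, coordVec e y j, coordVec e y k, coordVec e y l]

/-- The coordinates, in the chart `e`, of the points of `Ω`. -/
def region (Ω : Set M) (e : OpenPartialHomeomorph M Pt) : Set Pt := e.target ∩ e.symm ⁻¹' Ω

/-- Smoothness of a covariant 2-tensor field on the open set `Ω`. -/
def SmoothOn₂ (T : ∀ p : M, LinearMap.BilinForm ℝ (TangentSpace 𝓘(ℝ, Pt) p)) (Ω : Set M) : Prop :=
  ∀ e ∈ charts M, ∀ i j, ContDiffOn ℝ ∞ (fun y ↦ comp₂ T e y i j) (region Ω e)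

/-- Smoothness of a vector field on the open set `Ω` (through its covariant components). -/
def SmoothOn₁ (g : ∀ p : M, LinearMap.BilinForm ℝ (TangentSpace 𝓘(ℝ, Pt) p))
    (X : ∀ p : M, TangentSpace 𝓘(ℝ, Pt) p) (Ω : Set M) : Prop :=
  ∀ e ∈ charts M, ∀ i, ContDiffOn ℝ ∞ (fun y ↦ comp₁ g X e y i) (region Ω e)

/-- Orthonormal frames for the signature `(-+++)`. -/
def IsOrthonormalFrame {V : Type*} [AddCommGroup V] [Module ℝ V] (g : LinearMap.BilinForm ℝ V)
    (v : Fin 4 → V) : Prop :=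
  ∀ i j, g (v i) (v j) = if i = j then (if i = 0 then -1 else 1) else 0

variable (M) in
/-- A spacetime: a smooth Lorentzian metric of signature `(-+++)`, its volume form for an
orientation, and a timelike field giving the time orientation. -/
structure Spacetime where
  metric : ∀ p : M, LinearMap.BilinForm ℝ (TangentSpace 𝓘(ℝ, Pt) p)
  metric_symm : ∀ p u v, metric p u v = metric p v u
  lorentzian : ∀ p, ∃ v : Fin 4 → TangentSpace 𝓘(ℝ, Pt) p, IsOrthonormalFrame (metric p) v
  metric_smooth : SmoothOn₂ metric Set.univ
  vol : ∀ p : M, (TangentSpace 𝓘(ℝ, Pt) p) [⋀^Fin 4]→ₗ[ℝ] ℝ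
  vol_frame : ∀ p (v : Fin 4 → TangentSpace 𝓘(ℝ, Pt) p),
    IsOrthonormalFrame (metric p) v → vol p v = 1 ∨ vol p v = -1
  vol_smooth : ∀ e ∈ charts M, ∀ i j k l,
    ContDiffOn ℝ ∞ (fun y ↦ comp₄ vol e y i j k l) (region Set.univ e)
  time : ∀ p : M, TangentSpace 𝓘(ℝ, Pt) p
  time_timelike : ∀ p, metric p (time p) (time p) < 0
  time_smooth : SmoothOn₁ metric time Set.univ

namespace Spacetime

variable (S : Spacetime M) (Ω : Set M)

/-- The Weyl tensor is of Petrov-Bel type N on `Ω`: it does not vanish at any point and the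
square of the self-dual Weyl tensor is zero. -/
def IsTypeN : Prop :=
  ∀ e ∈ charts M, ∀ y ∈ region Ω e,
    weyl (comp₂ S.metric e) y ≠ 0 ∧ weylSDSq (comp₂ S.metric e) (comp₄ S.vol e) y = 0

/-- The components in the chart `e` of all the fields involved. -/
def fields (L : ∀ p : M, LinearMap.BilinForm ℝ (TangentSpace 𝓘(ℝ, Pt) p))
    (ℓ x : ∀ p : M, TangentSpace 𝓘(ℝ, Pt) p) (e : OpenPartialHomeomorph M Pt) : Fields where
  g := comp₂ S.metric e
  η := comp₄ S.vol e
  L := comp₂ L e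
  ℓ := comp₁ S.metric ℓ e
  x := comp₁ S.metric x e

/-- `x` is a smooth timelike vector field on `Ω`. -/
def IsTimelikeField (x : ∀ p : M, TangentSpace 𝓘(ℝ, Pt) p) : Prop :=
  SmoothOn₁ S.metric x Ω ∧ ∀ p ∈ Ω, S.metric p (x p) (x p) < 0

/-- `L` is a (smooth choice on `Ω` of the) fundamental 2-form of the type N Weyl tensor: the
bivector `𝓛 = (L - i *L)/√2` satisfies `𝓦 = 𝓛 ⊗ 𝓛`. -/
def IsFundamentalForm (L : ∀ p : M, LinearMap.BilinForm ℝ (TangentSpace 𝓘(ℝ, Pt) p)) : Prop :=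
  SmoothOn₂ L Ω ∧ (∀ p ∈ Ω, ∀ u, L p u u = 0) ∧
  ∀ e ∈ charts M, ∀ y ∈ region Ω e, ∀ i j k l,
    weylSD (comp₂ S.metric e) (comp₄ S.vol e) y i j k l =
      bivector (comp₂ L e y) (hodge (gInv (comp₂ S.metric e) y) (comp₄ S.vol e y) (comp₂ L e y)) i j
      * bivector (comp₂ L e y)
        (hodge (gInv (comp₂ S.metric e) y) (comp₄ S.vol e y) (comp₂ L e y)) k l

/-- `ℓ` is the fundamental vector of the null 2-form `L`: the future-pointing null vector with
`L = ℓ ∧ e₂` for a unit spacelike vector `e₂` orthogonal to `ℓ`. -/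
def IsFundamentalVector (L : ∀ p : M, LinearMap.BilinForm ℝ (TangentSpace 𝓘(ℝ, Pt) p))
    (ℓ : ∀ p : M, TangentSpace 𝓘(ℝ, Pt) p) : Prop :=
  ∀ p ∈ Ω, S.metric p (ℓ p) (ℓ p) = 0 ∧ S.metric p (ℓ p) (S.time p) < 0 ∧
    ∃ e₂ : TangentSpace 𝓘(ℝ, Pt) p, S.metric p e₂ e₂ = 1 ∧ S.metric p (ℓ p) e₂ = 0 ∧
      ∀ u v, L p u v =
        S.metric p (ℓ p) u * S.metric p e₂ v - S.metric p e₂ u * S.metric p (ℓ p) v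

/-- The family `Ĉ5`: `φ₁ = φ₂ = φ₃ = φ₄ = φ₅ = 0` on `Ω`. -/
def IsFamilyC5 (L : ∀ p : M, LinearMap.BilinForm ℝ (TangentSpace 𝓘(ℝ, Pt) p))
    (ℓ x : ∀ p : M, TangentSpace 𝓘(ℝ, Pt) p) : Prop :=
  ∀ e ∈ charts M, ∀ y ∈ region Ω e,
    (S.fields L ℓ x e).phi1 y = 0 ∧ (S.fields L ℓ x e).phi2 y = 0 ∧
    (S.fields L ℓ x e).phi3 y = 0 ∧ (S.fields L ℓ x e).phi4 y = 0 ∧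
    (S.fields L ℓ x e).phi5 y = 0

end Spacetime

end Manifold

end TypeN

end

/-!
On `Ω` the fundamental bivector is `𝓛 = (ℓ ∧ e₂ - i ℓ ∧ e₃)/√2` with `e₂`, `e₃` orthonormal vectors
orthogonal to the null vector `ℓ`; in a chart they may be chosen smooth (`Spacetime.isAdapted`), and
`ℓ` itself is smooth because `L_{ia} L_j^a = ℓ_i ℓ_j`.

For a vector `v` the square of `∇_v 𝓛` is `(p₃² - p₂²) + 2 i p₂ p₃` with `p_k = (∇_v ℓ, e_k)`, so it
vanishes only if `∇_v ℓ` is orthogonal to `e₂` and `e₃` (`IsAdapted.covBivL_null`). Since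
`a = (∇ℓ, e₂)` and `a* = -(∇ℓ, e₃)`, the condition `φ₁ = 0` makes `a`, `a*` orthogonal to `ℓ` and
`φ₂ = 0` makes them null, hence `a = α ℓ` and `a* = α* ℓ`. This amounts to
`∇_i ℓ_j = ℓ_i u_j + w_i ℓ_j` with `u` orthogonal to `ℓ` and `(u, u) = α² + α*²`, and then `b = u + w`.

As the Weyl tensor is the real part of `2 𝓛 ⊗ 𝓛`, it does not act on `ℓ`, and the Ricci identity for
`ℓ` involves the tensor `Q` only (`IsAdapted.ricci_identity_forms`). Evaluated on vectors orthogonal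
to `ℓ` it gives `Q(ℓ) = λ ℓ` and shows that `db` vanishes on the orthogonal complement of `ℓ`. Hence
`db = ℓ ∧ z`, and `(db, db) = -(ℓ, z)²` vanishes only if the contraction of `db` with `ℓ` does. The
Ricci identity identifies this contraction with `(2 λ + (u, u)) ℓ` (`IsAdapted.lam_eq`).

If `λ = 0` on an open set, then `u = 0` there, and the Ricci identity says that `Q` vanishes on the
orthogonal complement of `ℓ`. So `Q = ℓ ⊗ q + q ⊗ ℓ` with `(ℓ, q) = 0`, which is traceless, and
`Ric = 2 Q`. For null `q` the Ricci operator is a multiple of `ℓ ⊗ ℓ`, and for spacelike `q` it has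
the Jordan chain `A² x, A x, x`.
-/

noncomputable section

namespace TypeN

/-! ### Calculus of smooth components -/

theorem pd_contDiffOn {U : Set Pt} (hU : IsOpen U) {f : Pt → ℝ} (hf : ContDiffOn ℝ ∞ f U)
    (i : Fin 4) : ContDiffOn ℝ ∞ (pd i f) U :=
  (hf.fderiv_of_isOpen hU (by simp)).clm_apply contDiffOn_const

theorem diffAt_of_contDiffOn {U : Set Pt} (hU : IsOpen U) {f : Pt → ℝ} (hf : ContDiffOn ℝ ∞ f U)
    {y : Pt} (hy : y ∈ U) : DifferentiableAt ℝ f y :=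
  (hf.differentiableOn (by simp)).differentiableAt (hU.mem_nhds hy)

theorem pd_congr {U : Set Pt} (hU : IsOpen U) {f f' : Pt → ℝ} (h : ∀ z ∈ U, f z = f' z)
    {y : Pt} (hy : y ∈ U) (i : Fin 4) : pd i f y = pd i f' y := by
  have : f =ᶠ[nhds y] f' := Filter.eventuallyEq_of_mem (hU.mem_nhds hy) h
  simp only [pd, this.fderiv_eq]

section Rules

variable {f f' : Pt → ℝ} {y : Pt}

theorem pd_add (hf : DifferentiableAt ℝ f y) (hf' : DifferentiableAt ℝ f' y) (i : Fin 4) :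
    pd i (fun z ↦ f z + f' z) y = pd i f y + pd i f' y := by
  simp only [pd, fderiv_fun_add hf hf', add_apply]

theorem pd_sub (hf : DifferentiableAt ℝ f y) (hf' : DifferentiableAt ℝ f' y) (i : Fin 4) :
    pd i (fun z ↦ f z - f' z) y = pd i f y - pd i f' y := by
  simp only [pd, fderiv_fun_sub hf hf', sub_apply]

theorem pd_mul (hf : DifferentiableAt ℝ f y) (hf' : DifferentiableAt ℝ f' y) (i : Fin 4) :
    pd i (fun z ↦ f z * f' z) y = pd i f y * f' y + f y * pd i f' y := by
  simp only [pd, fderiv_fun_mul hf hf', add_apply, smul_apply, smul_eq_mul]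
  ring

theorem pd_const (c : ℝ) (i : Fin 4) : pd i (fun _ ↦ c) y = 0 := by
  simp [pd]

theorem pd_sum {F : Fin 4 → Pt → ℝ} (hF : ∀ m, DifferentiableAt ℝ (F m) y) (i : Fin 4) :
    pd i (fun z ↦ ∑ m, F m z) y = ∑ m, pd i (F m) y := by
  simp only [pd, fderiv_fun_sum (fun m _ ↦ hF m), sum_apply]

end Rules

/-- Partial derivatives of a smooth function commute. -/
theorem pd_comm {U : Set Pt} (hU : IsOpen U) {f : Pt → ℝ} (hf : ContDiffOn ℝ ∞ f U)
    {y : Pt} (hy : y ∈ U) (i j : Fin 4) : pd i (pd j f) y = pd j (pd i f) y := by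
  have hfy : ContDiffAt ℝ ∞ f y := hf.contDiffAt (hU.mem_nhds hy)
  have h2 : DifferentiableAt ℝ (fderiv ℝ f) y :=
    ((hf.fderiv_of_isOpen hU (m := ∞) (by simp)).differentiableOn (by simp)).differentiableAt
      (hU.mem_nhds hy)
  have key : ∀ k l : Fin 4, pd k (pd l f) y =
      fderiv ℝ (fderiv ℝ f) y (EuclideanSpace.single k 1) (EuclideanSpace.single l 1) := by
    intro k l
    have : pd l f = fun z ↦ fderiv ℝ f z (EuclideanSpace.single l 1) := rfl
    rw [this, pd, fderiv_clm_apply h2 (differentiableAt_const _)]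
    simp
  rw [key, key]
  exact (hfy.isSymmSndFDerivAt (by simp; norm_cast)) _ _

/-! ### The Levi-Civita connection -/

/-- The components of a smooth symmetric nondegenerate metric on an open set of coordinates. -/
structure IsMetricOn (g : Pt → Fin 4 → Fin 4 → ℝ) (U : Set Pt) : Prop where
  isOpen : IsOpen U
  smooth : ∀ i j, ContDiffOn ℝ ∞ (fun y ↦ g y i j) U
  symm : ∀ y i j, g y i j = g y j i
  det_ne : ∀ y ∈ U, (Matrix.of (g y)).det ≠ 0

theorem riemannUp_swap (g : Pt → Fin 4 → Fin 4 → ℝ) (y : Pt) (a b c d : Fin 4) :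
    riemannUp g y a b c d = -riemannUp g y a b d c := by
  simp only [riemannUp]; ring

namespace IsMetricOn

variable {g : Pt → Fin 4 → Fin 4 → ℝ} {U : Set Pt} (hg : IsMetricOn g U)
include hg

theorem g_mul_inv {y : Pt} (hy : y ∈ U) (i j : Fin 4) :
    ∑ k, g y i k * gInv g y k j = if i = j then 1 else 0 := by
  have h := Matrix.mul_nonsing_inv (Matrix.of (g y)) (Ne.isUnit (hg.det_ne y hy))
  have := congrFun (congrFun h i) j
  simpa [Matrix.mul_apply, Matrix.one_apply, gInv] using this

theorem inv_mul_g {y : Pt} (hy : y ∈ U) (i j : Fin 4) :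
    ∑ k, gInv g y i k * g y k j = if i = j then 1 else 0 := by
  have h := Matrix.nonsing_inv_mul (Matrix.of (g y)) (Ne.isUnit (hg.det_ne y hy))
  have := congrFun (congrFun h i) j
  simpa [Matrix.mul_apply, Matrix.one_apply, gInv] using this

theorem inv_symm (y : Pt) (i j : Fin 4) : gInv g y i j = gInv g y j i := by
  have h : (Matrix.of (g y)).transpose = Matrix.of (g y) := by
    ext a b; simp [Matrix.transpose_apply, hg.symm y a b]
  have h2 : (gInv g y).transpose = gInv g y := by
    rw [gInv, Matrix.transpose_nonsing_inv, h]
  exact congrFun (congrFun h2 j) i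

theorem inv_smooth (i j : Fin 4) : ContDiffOn ℝ ∞ (fun y ↦ gInv g y i j) U := by
  have hdet : ∀ A : Pt → Matrix (Fin 4) (Fin 4) ℝ, (∀ a b, ContDiffOn ℝ ∞ (fun y ↦ A y a b) U) →
      ContDiffOn ℝ ∞ (fun y ↦ (A y).det) U := by
    intro A hA
    simp only [Matrix.det_apply']
    refine ContDiffOn.sum fun σ _ ↦ contDiffOn_const.mul ?_
    exact contDiffOn_prod fun a _ ↦ hA _ _
  have h1 : ∀ y, gInv g y i j
      = (Matrix.of (g y)).det⁻¹ * ((Matrix.of (g y)).updateRow j (Pi.single i 1)).det := by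
    intro y
    rw [gInv, Matrix.inv_def, Matrix.smul_apply, Matrix.adjugate_apply, Ring.inverse_eq_inv',
      smul_eq_mul]
  simp only [h1]
  refine ContDiffOn.mul ?_ ?_
  · exact (hdet _ fun a b ↦ hg.smooth a b).inv hg.det_ne
  · refine hdet _ fun a b ↦ ?_
    by_cases h : a = j
    · subst h
      simpa using contDiffOn_const
    · simpa [Matrix.updateRow_ne h] using hg.smooth a b

theorem christoffel_smooth (k i j : Fin 4) : ContDiffOn ℝ ∞ (christoffel g k i j) U := by
  have h := fun a b c ↦ pd_contDiffOn hg.isOpen (hg.smooth a b) c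
  have h' := hg.inv_smooth
  have : christoffel g k i j = fun y ↦ (1 / 2) * ∑ m, gInv g y k m *
    (pd i (fun z ↦ g z m j) y + pd j (fun z ↦ g z m i) y - pd m (fun z ↦ g z i j) y) := rfl
  rw [this]
  refine contDiffOn_const.mul (ContDiffOn.sum fun m _ ↦ (h' k m).mul ?_)
  exact ((h _ _ _).add (h _ _ _)).sub (h _ _ _)

theorem christoffel_symm (k i j : Fin 4) (y : Pt) :
    christoffel g k i j y = christoffel g k j i y := by
  have : (fun z ↦ g z i j) = fun z ↦ g z j i := funext fun z ↦ hg.symm z i j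
  simp only [christoffel, this]
  congr 1
  refine Finset.sum_congr rfl fun m _ ↦ by ring

/-- The metric is parallel: `∂_i g_{jk} = Γ_{j,ik} + Γ_{k,ij}`. -/
theorem pd_g {y : Pt} (hy : y ∈ U) (i j k : Fin 4) :
    pd i (fun z ↦ g z j k) y =
      ∑ m, g y j m * christoffel g m i k y + ∑ m, g y k m * christoffel g m i j y := by
  have hs : ∀ a b, (fun z ↦ g z a b) = fun z ↦ g z b a := fun a b ↦ funext fun z ↦ hg.symm z a b
  have low : ∀ a b c, ∑ m, g y a m * christoffel g m b c y = (1 / 2) *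
      (pd b (fun z ↦ g z a c) y + pd c (fun z ↦ g z a b) y - pd a (fun z ↦ g z b c) y) := by
    intro a b c
    have : ∀ n, ∑ m, g y a m * (gInv g y m n) = if a = n then 1 else 0 := hg.g_mul_inv hy a
    simp only [christoffel]
    set T : Fin 4 → ℝ := fun m ↦
      pd b (fun z ↦ g z m c) y + pd c (fun z ↦ g z m b) y - pd m (fun z ↦ g z b c) y with hT
    calc ∑ m, g y a m * (1 / 2 * ∑ n, gInv g y m n * T n)
        = (1 / 2) * ∑ n, (∑ m, g y a m * gInv g y m n) * T n := by
          simp only [Finset.mul_sum, Finset.sum_mul]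
          rw [Finset.sum_comm]
          exact Finset.sum_congr rfl fun _ _ ↦ Finset.sum_congr rfl fun _ _ ↦ by ring
      _ = (1 / 2) * T a := by simp [this]
  rw [low, low, hs k j, hs i k, hs i j]
  ring

/-- The inverse metric is parallel. -/
theorem pd_inv {y : Pt} (hy : y ∈ U) (i j k : Fin 4) :
    pd i (fun z ↦ gInv g z j k) y =
      -∑ m, christoffel g j i m y * gInv g y m k - ∑ m, christoffel g k i m y * gInv g y j m := by
  have hd := fun a b ↦ diffAt_of_contDiffOn hg.isOpen (hg.smooth a b) hy
  have hd' := fun a b ↦ diffAt_of_contDiffOn hg.isOpen (hg.inv_smooth a b) hy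
  -- differentiate `h g = 1`
  have h1 : ∀ b, ∑ a, pd i (fun z ↦ gInv g z j a) y * g y a b
      = -∑ a, gInv g y j a * pd i (fun z ↦ g z a b) y := by
    intro b
    have h0 : pd i (fun z ↦ ∑ a, gInv g z j a * g z a b) y = 0 := by
      rw [pd_congr hg.isOpen (f' := fun _ ↦ if j = b then 1 else 0)
        (fun z hz ↦ hg.inv_mul_g hz j b) hy, pd_const]
    rw [pd_sum (fun a ↦ (hd' j a).fun_mul (hd a b))] at h0
    simp only [pd_mul (hd' _ _) (hd _ _), Finset.sum_add_distrib] at h0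
    linarith
  have h2 : pd i (fun z ↦ gInv g z j k) y
      = ∑ b, (∑ a, pd i (fun z ↦ gInv g z j a) y * g y a b) * gInv g y b k := by
    simp only [Finset.sum_mul]
    rw [Finset.sum_comm]
    simp only [mul_assoc, ← Finset.mul_sum, hg.g_mul_inv hy]
    simp
  have h3 : ∀ a m, ∑ b, g y b m * gInv g y b a = if m = a then 1 else 0 := fun a m ↦ by
    rw [← hg.g_mul_inv hy m a]
    exact Finset.sum_congr rfl fun b _ ↦ by rw [hg.symm]
  rw [h2]
  simp only [h1, hg.pd_g hy, mul_add, Finset.sum_add_distrib, neg_mul, add_mul, neg_add_rev,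
    Finset.sum_neg_distrib]
  have e1 : ∑ b, (∑ a, gInv g y j a * ∑ m, g y a m * christoffel g m i b y) * gInv g y b k
      = ∑ m, christoffel g j i m y * gInv g y m k := by
    refine Finset.sum_congr rfl fun b _ ↦ ?_
    congr 1
    simp only [Finset.mul_sum]
    rw [Finset.sum_comm]
    simp only [← mul_assoc, ← Finset.sum_mul, hg.inv_mul_g hy]
    simp
  have e2 : ∑ b, (∑ a, gInv g y j a * ∑ m, g y b m * christoffel g m i a y) * gInv g y b k
      = ∑ m, christoffel g k i m y * gInv g y j m := by
    simp only [Finset.sum_mul]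
    rw [Finset.sum_comm]
    refine Finset.sum_congr rfl fun a _ ↦ ?_
    simp only [Finset.mul_sum, Finset.sum_mul]
    rw [Finset.sum_comm]
    calc ∑ m, ∑ b, gInv g y j a * (g y b m * christoffel g m i a y) * gInv g y b k
        = ∑ m, (∑ b, g y b m * gInv g y b k) * (gInv g y j a * christoffel g m i a y) := by
          simp only [Finset.sum_mul]
          exact Finset.sum_congr rfl fun _ _ ↦ Finset.sum_congr rfl fun _ _ ↦ by ring
      _ = _ := by simp [h3, mul_comm]
  rw [e1, e2]
  ring

theorem cov₁_smooth {v : Pt → Fin 4 → ℝ} (hv : ∀ j, ContDiffOn ℝ ∞ (fun y ↦ v y j) U)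
    (i j : Fin 4) : ContDiffOn ℝ ∞ (fun y ↦ cov₁ g v y i j) U :=
  (pd_contDiffOn hg.isOpen (hv j) i).sub
    (ContDiffOn.sum fun m _ ↦ (hg.christoffel_smooth m i j).mul (hv m))

/-- Leibniz rule for the scalar product of two 1-forms. -/
theorem pd_ip {v w : Pt → Fin 4 → ℝ} (hv : ∀ j, ContDiffOn ℝ ∞ (fun y ↦ v y j) U)
    (hw : ∀ j, ContDiffOn ℝ ∞ (fun y ↦ w y j) U) {y : Pt} (hy : y ∈ U) (i : Fin 4) :
    pd i (fun z ↦ ip (gInv g z) (v z) (w z)) y =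
      ip (gInv g y) (cov₁ g v y i) (w y) + ip (gInv g y) (v y) (cov₁ g w y i) := by
  have dv := fun j ↦ diffAt_of_contDiffOn hg.isOpen (hv j) hy
  have dw := fun j ↦ diffAt_of_contDiffOn hg.isOpen (hw j) hy
  have dh := fun a b ↦ diffAt_of_contDiffOn hg.isOpen (hg.inv_smooth a b) hy
  have dr : ∀ a, DifferentiableAt ℝ (fun z ↦ ∑ b, gInv g z a b * w z b) y := fun a ↦
    DifferentiableAt.fun_sum fun b _ ↦ (dh a b).fun_mul (dw b)
  simp only [ip, raise]
  rw [pd_sum (fun a ↦ (dv a).fun_mul (dr a))]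
  simp only [pd_mul (dv _) (dr _), pd_sum (fun b ↦ (dh _ b).fun_mul (dw b)), pd_mul (dh _ _) (dw _),
    hg.pd_inv hy, cov₁]
  have hsym := hg.christoffel_symm
  simp only [Fin.sum_univ_four]
  ring

theorem ip_cov_of_const {v w : Pt → Fin 4 → ℝ} (hv : ∀ j, ContDiffOn ℝ ∞ (fun y ↦ v y j) U)
    (hw : ∀ j, ContDiffOn ℝ ∞ (fun y ↦ w y j) U) {c : ℝ}
    (h : ∀ z ∈ U, ip (gInv g z) (v z) (w z) = c) {y : Pt} (hy : y ∈ U) (i : Fin 4) :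
    ip (gInv g y) (cov₁ g v y i) (w y) + ip (gInv g y) (v y) (cov₁ g w y i) = 0 := by
  rw [← hg.pd_ip hv hw hy, pd_congr hg.isOpen h hy, pd_const]

/-- Leibniz rule for a tensor product of two 1-forms. -/
theorem cov₂_tmul {v w : Pt → Fin 4 → ℝ} (hv : ∀ j, ContDiffOn ℝ ∞ (fun y ↦ v y j) U)
    (hw : ∀ j, ContDiffOn ℝ ∞ (fun y ↦ w y j) U) {y : Pt} (hy : y ∈ U) (i j k : Fin 4) :
    cov₂ g (fun z a b ↦ v z a * w z b) y i j k =
      cov₁ g v y i j * w y k + v y j * cov₁ g w y i k := by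
  have dv := fun j ↦ diffAt_of_contDiffOn hg.isOpen (hv j) hy
  have dw := fun j ↦ diffAt_of_contDiffOn hg.isOpen (hw j) hy
  simp only [cov₂, cov₁, pd_mul (dv _) (dw _), Fin.sum_univ_four]
  ring

theorem cov₂_add {S T : Pt → Fin 4 → Fin 4 → ℝ}
    (hS : ∀ j k, ContDiffOn ℝ ∞ (fun y ↦ S y j k) U)
    (hT : ∀ j k, ContDiffOn ℝ ∞ (fun y ↦ T y j k) U) {y : Pt} (hy : y ∈ U) (i j k : Fin 4) :
    cov₂ g (fun z a b ↦ S z a b + T z a b) y i j k = cov₂ g S y i j k + cov₂ g T y i j k := by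
  have dS := fun j k ↦ diffAt_of_contDiffOn hg.isOpen (hS j k) hy
  have dT := fun j k ↦ diffAt_of_contDiffOn hg.isOpen (hT j k) hy
  simp only [cov₂, pd_add (dS _ _) (dT _ _), mul_add, Finset.sum_add_distrib]
  ring

/-- Leibniz rule for the exterior product of two 1-forms. -/
theorem cov₂_wedge {v w : Pt → Fin 4 → ℝ} (hv : ∀ j, ContDiffOn ℝ ∞ (fun y ↦ v y j) U)
    (hw : ∀ j, ContDiffOn ℝ ∞ (fun y ↦ w y j) U) {y : Pt} (hy : y ∈ U) (i j k : Fin 4) :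
    cov₂ g (fun z ↦ wedge (v z) (w z)) y i j k =
      wedge (cov₁ g v y i) (w y) j k + wedge (v y) (cov₁ g w y i) j k := by
  have dv := fun j ↦ diffAt_of_contDiffOn hg.isOpen (hv j) hy
  have dw := fun j ↦ diffAt_of_contDiffOn hg.isOpen (hw j) hy
  simp only [cov₂, cov₁, wedge, pd_sub ((dv _).fun_mul (dw _)) ((dw _).fun_mul (dv _)), pd_mul (dv _) (dw _),
    pd_mul (dw _) (dv _), Fin.sum_univ_four]
  ring

theorem cov₂_congr {S T : Pt → Fin 4 → Fin 4 → ℝ} (h : ∀ z ∈ U, S z = T z) {y : Pt} (hy : y ∈ U)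
    (i j k : Fin 4) : cov₂ g S y i j k = cov₂ g T y i j k := by
  simp only [cov₂, pd_congr hg.isOpen (fun z hz ↦ congrFun (congrFun (h z hz) j) k) hy, h y hy]

theorem extD_eq (v : Pt → Fin 4 → ℝ) (y : Pt) (i j : Fin 4) :
    extD v y i j = cov₁ g v y i j - cov₁ g v y j i := by
  simp only [extD, cov₁, hg.christoffel_symm _ j i]
  ring

/-! ### Curvature -/

/-- The Ricci identity for a 1-form. -/
theorem ricci_identity {v : Pt → Fin 4 → ℝ} (hv : ∀ j, ContDiffOn ℝ ∞ (fun y ↦ v y j) U)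
    {y : Pt} (hy : y ∈ U) (b c d : Fin 4) :
    cov₂ g (cov₁ g v) y c d b - cov₂ g (cov₁ g v) y d c b = -∑ a, riemannUp g y a b c d * v y a := by
  have dv := fun j ↦ diffAt_of_contDiffOn hg.isOpen (hv j) hy
  have dpv := fun i j ↦ diffAt_of_contDiffOn hg.isOpen (pd_contDiffOn hg.isOpen (hv j) i) hy
  have dΓ := fun k i j ↦ diffAt_of_contDiffOn hg.isOpen (hg.christoffel_smooth k i j) hy
  have dΓv : ∀ i j, DifferentiableAt ℝ (fun z ↦ ∑ m, christoffel g m i j z * v z m) y := fun i j ↦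
    DifferentiableAt.fun_sum fun m _ ↦ (dΓ m i j).fun_mul (dv m)
  have hc := pd_comm hg.isOpen (hv b) hy c d
  simp only [cov₂, pd_sub (dpv _ _) (dΓv _ _), pd_sum (fun m ↦ (dΓ m _ _).fun_mul (dv m)),
    pd_mul (dΓ _ _ _) (dv _), hc, riemannUp, hg.christoffel_symm _ d c, cov₁]
  simp only [Fin.sum_univ_four]
  ring

/-- The first Bianchi identity. -/
theorem bianchi (y : Pt) (a b c d : Fin 4) :
    riemannUp g y a b c d + riemannUp g y a c d b + riemannUp g y a d b c = 0 := by
  have hs : ∀ k i j, christoffel g k i j = christoffel g k j i := fun k i j ↦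
    funext fun y ↦ hg.christoffel_symm k i j y
  simp only [riemannUp, hs _ d b, hs _ c b, hs _ d c]
  ring

theorem riemannUp_smooth (a b c d : Fin 4) : ContDiffOn ℝ ∞ (fun y ↦ riemannUp g y a b c d) U := by
  have h := hg.christoffel_smooth
  have h' := fun k i j m ↦ pd_contDiffOn hg.isOpen (hg.christoffel_smooth k i j) m
  exact (((h' _ _ _ _).sub (h' _ _ _ _)).add
    (ContDiffOn.sum fun e _ ↦ (h _ _ _).mul (h _ _ _))).sub
    (ContDiffOn.sum fun e _ ↦ (h _ _ _).mul (h _ _ _))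

theorem Q_smooth (i j : Fin 4) : ContDiffOn ℝ ∞ (fun y ↦ Q g y i j) U := by
  have hR : ∀ b d, ContDiffOn ℝ ∞ (fun y ↦ ricci g y b d) U := fun b d ↦
    ContDiffOn.sum fun a _ ↦ hg.riemannUp_smooth _ _ _ _
  have hr : ContDiffOn ℝ ∞ (scalarCurv g) U :=
    ContDiffOn.sum fun a _ ↦ ContDiffOn.sum fun b _ ↦ (hg.inv_smooth a b).mul (hR a b)
  exact contDiffOn_const.mul ((hR i j).sub ((hr.div_const 6).mul (hg.smooth i j)))

theorem riemannUp_eq {y : Pt} (hy : y ∈ U) (a b c d : Fin 4) :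
    riemannUp g y a b c d = ∑ e, gInv g y a e * riemann g y e b c d := by
  simp only [riemann, Finset.mul_sum]
  rw [Finset.sum_comm]
  simp only [← mul_assoc, ← Finset.sum_mul, hg.inv_mul_g hy]
  simp

/-- The Ricci tensor is symmetric if the curvature is antisymmetric in its first two indices. -/
theorem ricci_symm {y : Pt} (hy : y ∈ U)
    (hR : ∀ a b c d, riemann g y a b c d = -riemann g y b a c d) (b d : Fin 4) :
    ricci g y b d = ricci g y d b := by
  have htr : ∑ a, riemannUp g y a a d b = 0 := by
    have h1 : ∑ a, riemannUp g y a a d b = -∑ a, riemannUp g y a a d b := by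
      simp only [hg.riemannUp_eq hy]
      conv_lhs => rw [Finset.sum_comm]
      rw [← Finset.sum_neg_distrib]
      refine Finset.sum_congr rfl fun a _ ↦ ?_
      rw [← Finset.sum_neg_distrib]
      refine Finset.sum_congr rfl fun e _ ↦ ?_
      rw [hg.inv_symm y e a, hR a e]
      ring
    linarith
  have := Finset.sum_congr rfl (fun a (_ : a ∈ (Finset.univ : Finset (Fin 4))) ↦ hg.bianchi y a b a d)
  simp only [Finset.sum_add_distrib, htr, Finset.sum_const_zero] at this
  simp only [riemannUp_swap g y _ d b, Finset.sum_neg_distrib] at this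
  simp only [ricci]
  linarith

end IsMetricOn

/-! ### Linear algebra at a point -/

section Abstract

variable {V : Type*} [AddCommGroup V] [Module ℝ V]

/-- A null vector `ℓ` together with two orthonormal spacelike vectors spanning its orthogonal
complement, and a vector `x` transversal to that complement. -/
structure IsScreen (g : LinearMap.BilinForm ℝ V) (ℓ e₂ e₃ x : V) : Prop where
  symm : ∀ X Y, g X Y = g Y X
  ll : g ℓ ℓ = 0
  l2 : g ℓ e₂ = 0
  l3 : g ℓ e₃ = 0
  e22 : g e₂ e₂ = 1
  e33 : g e₃ e₃ = 1
  e23 : g e₂ e₃ = 0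
  lx : g ℓ x ≠ 0
  span : ∀ X, g ℓ X = 0 → g e₂ X = 0 → g e₃ X = 0 → ∃ c : ℝ, X = c • ℓ

namespace IsScreen

variable {g : LinearMap.BilinForm ℝ V} {ℓ e₂ e₃ x : V} (hs : IsScreen g ℓ e₂ e₃ x)
include hs

theorem exists_expand {X : V} (hX : g ℓ X = 0) :
    ∃ c : ℝ, X = c • ℓ + g e₂ X • e₂ + g e₃ X • e₃ := by
  obtain ⟨c, hc⟩ := hs.span (X - g e₂ X • e₂ - g e₃ X • e₃)
    (by simp [hs.l2, hs.l3, hX]) (by simp [hs.e22, hs.e23])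
    (by simp [hs.symm e₃ e₂, hs.e33, hs.e23])
  exact ⟨c, by rw [← hc]; abel⟩

/-- On the orthogonal complement of `ℓ` the scalar product is that of the screen components. -/
theorem inner_eq {X Y : V} (hX : g ℓ X = 0) (hY : g ℓ Y = 0) :
    g X Y = g e₂ X * g e₂ Y + g e₃ X * g e₃ Y := by
  obtain ⟨c, hc⟩ := hs.exists_expand hX
  conv_lhs => rw [hc]
  simp [hY]

/-- A null vector orthogonal to `ℓ` is a multiple of `ℓ`. -/
theorem eq_smul_of_null {X : V} (hX : g ℓ X = 0) (h0 : g X X = 0) : X = (g X x / g ℓ x) • ℓ := by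
  have h1 := hs.inner_eq hX hX
  rw [h0] at h1
  obtain ⟨c, rfl⟩ := hs.span X hX (by nlinarith [sq_nonneg (g e₂ X), sq_nonneg (g e₃ X)])
    (by nlinarith [sq_nonneg (g e₂ X), sq_nonneg (g e₃ X)])
  simp [hs.lx]

/-- A linear form vanishing on `ℓ`, `e₂`, `e₃` vanishes on the orthogonal complement of `ℓ`. -/
theorem form_eq_zero {f : V →ₗ[ℝ] ℝ} (h1 : f ℓ = 0) (h2 : f e₂ = 0) (h3 : f e₃ = 0) {X : V}
    (hX : g ℓ X = 0) : f X = 0 := by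
  obtain ⟨c, hc⟩ := hs.exists_expand hX
  rw [hc]
  simp [h1, h2, h3]

/-- The projection of `X` along `x` lies in the orthogonal complement of `ℓ`. -/
theorem proj_mem (X : V) : g ℓ (X - (g ℓ X / g ℓ x) • x) = 0 := by
  have := hs.lx
  simp; field_simp; simp

/-- If `∇ℓ`, contracted with `ℓ`, vanishes and contracted with the screen vectors is
proportional to `ℓ`, then `∇ℓ = ℓ ⊗ u + w ⊗ ℓ`, where `u(x) = 0`. -/
theorem grad_decomp {T : LinearMap.BilinForm ℝ V} {α β : ℝ} (h1 : ∀ X, T X ℓ = 0)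
    (h2 : ∀ X, T X e₂ = α * g ℓ X) (h3 : ∀ X, T X e₃ = β * g ℓ X) (X Y : V) :
    T X Y = g ℓ X * ((T x Y - T x x / g ℓ x * g ℓ Y) / g ℓ x) + T X x / g ℓ x * g ℓ Y := by
  have hlx := hs.lx
  have key := hs.form_eq_zero (f := g ℓ x • T X - g ℓ X • T x) (by simp [h1])
    (by simp [h2]; ring) (by simp [h3]; ring) (hs.proj_mem Y)
  simp only [map_sub, map_smul, LinearMap.sub_apply, LinearMap.smul_apply, smul_eq_mul] at key
  field_simp at key ⊢
  linarith

/-- A 2-form vanishing on the orthogonal complement of `ℓ` is divisible by `ℓ`. -/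
theorem twoForm_eq {F : LinearMap.BilinForm ℝ V} (hF : ∀ X Y, F X Y = -F Y X)
    (h0 : ∀ X Y, g ℓ X = 0 → g ℓ Y = 0 → F X Y = 0) (X Y : V) :
    F X Y = g ℓ X * (F x Y / g ℓ x) - F x X / g ℓ x * g ℓ Y := by
  have hlx := hs.lx
  have key := h0 _ _ (hs.proj_mem X) (hs.proj_mem Y)
  have hxx : F x x = 0 := by linarith [hF x x]
  simp only [map_sub, map_smul, LinearMap.sub_apply, LinearMap.smul_apply, smul_eq_mul, hxx, hF X x] at key
  field_simp at key ⊢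
  exact mul_left_cancel₀ hlx (by linarith)

section Ricci

variable {Q Du dw : LinearMap.BilinForm ℝ V} {u : V} (hQ : ∀ X Y, Q X Y = Q Y X)
  (star : ∀ X Y Z, (g ℓ X * g u Y - g u X * g ℓ Y) * g u Z + g ℓ Y * Du X Z - g ℓ X * Du Y Z
    + dw X Y * g ℓ Z
    = g X Z * Q ℓ Y - g Y Z * Q ℓ X - g ℓ X * Q Y Z + g ℓ Y * Q X Z)
include star

/-- The Ricci identity for `ℓ`, evaluated on pairs of vectors orthogonal to `ℓ`, shows that
`Q(ℓ)` is proportional to `ℓ`. -/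
theorem eigen (X : V) : Q ℓ X = Q ℓ x / g ℓ x * g ℓ X := by
  have hlx := hs.lx
  have s := hs.symm
  have hl2 : Q ℓ e₂ = 0 := by
    have := star e₂ e₃ e₃
    simp [hs.l2, hs.l3, hs.e33, hs.e23] at this
    exact this
  have hl3 : Q ℓ e₃ = 0 := by
    have := star e₃ e₂ e₂
    simp [hs.l2, hs.l3, hs.e22, hs.e23, s e₃ e₂] at this
    exact this
  have hll : Q ℓ ℓ = 0 := by
    have := star ℓ e₂ e₂
    simp [hs.l2, hs.ll, hs.e22] at this
    exact this
  have key := hs.form_eq_zero hll hl2 hl3 (hs.proj_mem X)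
  simp only [map_sub, map_smul, smul_eq_mul] at key
  field_simp at key ⊢
  linarith

theorem eigen_perp {X : V} (hX : g ℓ X = 0) : Q ℓ X = 0 := by
  rw [hs.eigen star, hX, mul_zero]

theorem dw_perp {X Y : V} (hX : g ℓ X = 0) (hY : g ℓ Y = 0) : dw X Y = 0 := by
  have := star X Y x
  simp only [hX, hY, hs.eigen_perp star hX, hs.eigen_perp star hY] at this
  simpa [hs.lx] using this

include hQ

/-- The exterior derivative of `b = u + w` vanishes on the orthogonal complement of `ℓ`. -/
theorem db_perp {X Y : V} (hX : g ℓ X = 0) (hY : g ℓ Y = 0) :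
    Du X Y - Du Y X + dw X Y = 0 := by
  have h1 := star X x Y
  have h2 := star Y x X
  simp only [hX, hY, hs.eigen_perp star hX, hs.eigen_perp star hY, hs.symm Y X, hQ Y X] at h1 h2
  rw [hs.dw_perp star hX hY, add_zero]
  have : g ℓ x * (Du X Y - Du Y X) = 0 := by linarith
  simpa [hs.lx] using this

omit hQ in
/-- The component `db(ℓ, x)` equals `(2λ + (u,u)) (ℓ,x)`. -/
theorem db_l_x (hu : g u ℓ = 0) (hDu : Du x ℓ = -(g ℓ x * g u u)) :
    Du ℓ x - Du x ℓ + dw ℓ x = (2 * (Q ℓ x / g ℓ x) + g u u) * g ℓ x := by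
  have hlx := hs.lx
  have h1 := star ℓ x x
  simp only [hs.ll, hu, hs.eigen_perp star hs.ll] at h1
  have : g ℓ x * (Du ℓ x + dw ℓ x) = g ℓ x * (2 * Q ℓ x) := by linarith
  have h2 := mul_left_cancel₀ hlx this
  rw [hDu]
  field_simp
  linarith

/-- If `u = 0` and `λ = 0`, the Ricci identity leaves no component of `Q` on the orthogonal
complement of `ℓ`, so that `Q` is a symmetrized product of `ℓ` with a vector. -/
theorem Q_eq (hu : u = 0) (hDu : Du = 0) (h0 : Q ℓ x = 0) (X Y : V) :
    Q X Y = g ℓ X * ((Q x Y - Q x x / (2 * g ℓ x) * g ℓ Y) / g ℓ x)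
      + (Q x X - Q x x / (2 * g ℓ x) * g ℓ X) / g ℓ x * g ℓ Y := by
  have hlx := hs.lx
  have hl : ∀ Z, Q ℓ Z = 0 := fun Z ↦ by rw [hs.eigen star, h0]; simp
  have hperp : ∀ X Y, g ℓ X = 0 → g ℓ Y = 0 → Q X Y = 0 := by
    intro X Y hX hY
    have := star x X Y
    simp [hX, hY, hl, hDu, hu] at this
    simpa [hs.lx] using this
  have key := hperp _ _ (hs.proj_mem X) (hs.proj_mem Y)
  simp only [map_sub, map_smul, LinearMap.sub_apply, LinearMap.smul_apply, smul_eq_mul, hQ X x] at key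
  field_simp at key ⊢
  linarith

end Ricci

end IsScreen

end Abstract

/-! ### Components and bilinear forms -/

section Forms

variable (h : Matrix (Fin 4) (Fin 4) ℝ)

theorem raise_add (v w : Fin 4 → ℝ) : raise h (v + w) = raise h v + raise h w := by
  ext i; simp [raise, mul_add, Finset.sum_add_distrib]

theorem raise_smul (c : ℝ) (v : Fin 4 → ℝ) : raise h (c • v) = c • raise h v := by
  ext i; simp [raise, Finset.mul_sum, mul_left_comm]

/-- The bilinear form `B(X, Y) = B_{ij} X^i Y^j` on covectors, as a bundled object. -/
def appForm (B : Fin 4 → Fin 4 → ℝ) : LinearMap.BilinForm ℝ (Fin 4 → ℝ) :=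
  LinearMap.mk₂ ℝ (app₂ h B)
    (fun a b c ↦ by simp [app₂, raise_add, add_mul, Finset.sum_add_distrib])
    (fun c a b ↦ by simp [app₂, raise_smul, Finset.mul_sum, mul_assoc])
    (fun a b c ↦ by simp [app₂, app, raise_add, mul_add, Finset.sum_add_distrib])
    (fun c a b ↦ by simp [app₂, app, raise_smul, Finset.mul_sum, mul_left_comm])

/-- The scalar product of covectors, as a bundled bilinear form. -/
def ipBil : LinearMap.BilinForm ℝ (Fin 4 → ℝ) :=
  LinearMap.mk₂ ℝ (ip h)
    (fun a b c ↦ by simp [ip, add_mul, Finset.sum_add_distrib])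
    (fun c a b ↦ by simp [ip, Finset.mul_sum, mul_assoc])
    (fun a b c ↦ by simp [ip, raise_add, mul_add, Finset.sum_add_distrib])
    (fun c a b ↦ by simp [ip, raise_smul, Finset.mul_sum, mul_left_comm])

theorem appForm_apply (B : Fin 4 → Fin 4 → ℝ) (X Y : Fin 4 → ℝ) :
    appForm h B X Y = app₂ h B X Y := rfl

theorem ipBil_apply (X Y : Fin 4 → ℝ) : ipBil h X Y = ip h X Y := rfl

variable {h}

theorem ip_comm (hh : ∀ i j, h i j = h j i) (v w : Fin 4 → ℝ) : ip h v w = ip h w v := by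
  simp only [ip, raise, Finset.mul_sum]
  rw [Finset.sum_comm]
  exact Finset.sum_congr rfl fun i _ ↦ Finset.sum_congr rfl fun j _ ↦ by rw [hh j i]; ring

theorem app₂_eq_ip (hh : ∀ i j, h i j = h j i) (B : Fin 4 → Fin 4 → ℝ) (X Y : Fin 4 → ℝ) :
    app₂ h B X Y = ip h X (app h B Y) := by
  rw [ip_comm hh]
  exact Finset.sum_congr rfl fun i _ ↦ mul_comm _ _

theorem app₂_eq_sum (B : Fin 4 → Fin 4 → ℝ) (X Y : Fin 4 → ℝ) :
    app₂ h B X Y = ∑ i, raise h X i * ip h (B i) Y := rfl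

theorem app₂_tmul (v w X Y : Fin 4 → ℝ) :
    app₂ h (fun i j ↦ v i * w j) X Y = ip h v X * ip h w Y := by
  simp only [app₂, app, ip]
  rw [Finset.sum_mul_sum]
  refine Finset.sum_congr rfl fun i _ ↦ ?_
  rw [Finset.mul_sum]
  exact Finset.sum_congr rfl fun _ _ ↦ by ring

theorem app₂_add (F G : Fin 4 → Fin 4 → ℝ) (X Y : Fin 4 → ℝ) :
    app₂ h (fun i j ↦ F i j + G i j) X Y = app₂ h F X Y + app₂ h G X Y := by
  simp only [app₂, app, add_mul, mul_add, Finset.sum_add_distrib]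

theorem app₂_sub (F G : Fin 4 → Fin 4 → ℝ) (X Y : Fin 4 → ℝ) :
    app₂ h (fun i j ↦ F i j - G i j) X Y = app₂ h F X Y - app₂ h G X Y := by
  simp only [app₂, app, sub_mul, mul_sub, Finset.sum_sub_distrib]

theorem app₂_swap (F : Fin 4 → Fin 4 → ℝ) (X Y : Fin 4 → ℝ) :
    app₂ h (fun i j ↦ F j i) X Y = app₂ h F Y X := by
  simp only [app₂, app, Finset.mul_sum]
  rw [Finset.sum_comm]
  exact Finset.sum_congr rfl fun _ _ ↦ Finset.sum_congr rfl fun _ _ ↦ by ring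

/-- The contraction of the first index of `B` with `v`. -/
theorem ip_contract (v : Fin 4 → ℝ) (B : Fin 4 → Fin 4 → ℝ) (X : Fin 4 → ℝ) :
    ip h (fun j ↦ ∑ i, raise h v i * B i j) X = app₂ h B v X := by
  simp only [ip, app₂, app, Finset.mul_sum, Finset.sum_mul]
  rw [Finset.sum_comm]
  exact Finset.sum_congr rfl fun _ _ ↦ Finset.sum_congr rfl fun _ _ ↦ by ring

theorem ip_lin_comb (a b : ℝ) (v w X : Fin 4 → ℝ) :
    ip h (fun j ↦ a * (v j - b * w j)) X = a * (ip h v X - b * ip h w X) := by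
  simp only [ip, Finset.mul_sum, ← Finset.sum_sub_distrib]
  exact Finset.sum_congr rfl fun _ _ ↦ by ring

theorem ipForm_add_left (F G K : Fin 4 → Fin 4 → ℝ) :
    ipForm h (F + G) K = ipForm h F K + ipForm h G K := by
  simp only [ipForm, Pi.add_apply, mul_add, add_mul, Finset.sum_add_distrib]

theorem ipForm_add_right (F G K : Fin 4 → Fin 4 → ℝ) :
    ipForm h K (F + G) = ipForm h K F + ipForm h K G := by
  simp only [ipForm, Pi.add_apply, mul_add, Finset.sum_add_distrib]

theorem ipForm_wedge (a b c d : Fin 4 → ℝ) :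
    ipForm h (wedge a b) (wedge c d) = ip h a c * ip h b d - ip h a d * ip h b c := by
  have key : ∀ a b c d : Fin 4 → ℝ, ∑ i, ∑ j, ∑ k, ∑ l, h i k * h j l * (a i * b j) * (c k * d l)
      = ip h a c * ip h b d := by
    intro a b c d
    simp only [ip, raise, Finset.sum_mul_sum]
    refine Finset.sum_congr rfl fun i _ ↦ Finset.sum_congr rfl fun j _ ↦ ?_
    rw [mul_mul_mul_comm, Finset.sum_mul_sum]
    simp only [Finset.mul_sum]
    exact Finset.sum_congr rfl fun l _ ↦ Finset.sum_congr rfl fun k _ ↦ by ring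
  have h1 : ∀ i j k l, h i k * h j l * wedge a b i j * wedge c d k l
      = h i k * h j l * (a i * b j) * (c k * d l) - h i k * h j l * (a i * b j) * (d k * c l)
      - h i k * h j l * (b i * a j) * (c k * d l) + h i k * h j l * (b i * a j) * (d k * c l) := by
    intros; simp only [wedge]; ring
  simp only [ipForm, h1, Finset.sum_add_distrib, Finset.sum_sub_distrib, key]
  ring

/-- The square of the bivector `(F - i S)/√2`. -/
theorem ipBiv_bivector (F S : Fin 4 → Fin 4 → ℝ) :
    ipBiv h (bivector F S) (bivector F S) =
      (((ipForm h F F - ipForm h S S) / 2 : ℝ) : ℂ)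
        - Complex.I * (((ipForm h F S + ipForm h S F) / 2 : ℝ) : ℂ) := by
  have h2 : (Real.sqrt 2 : ℂ) * (Real.sqrt 2 : ℂ) = 2 := by
    rw [← Complex.ofReal_mul, Real.mul_self_sqrt (by norm_num)]; norm_num
  have hne : (Real.sqrt 2 : ℂ) ≠ 0 := by
    intro h0; rw [h0] at h2; norm_num at h2
  have key : ∀ i j k l, (h i k : ℂ) * (h j l : ℂ) * bivector F S i j * bivector F S k l
      = (1 / 2) * ((h i k : ℂ) * (h j l : ℂ) * F i j * F k l)
        - (1 / 2) * ((h i k : ℂ) * (h j l : ℂ) * S i j * S k l)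
        - Complex.I / 2 * ((h i k : ℂ) * (h j l : ℂ) * F i j * S k l)
        - Complex.I / 2 * ((h i k : ℂ) * (h j l : ℂ) * S i j * F k l) := by
    intro i j k l
    have : ∀ z w : ℂ, z / (Real.sqrt 2 : ℂ) * (w / (Real.sqrt 2 : ℂ)) = z * w / 2 := by
      intro z w; rw [div_mul_div_comm, h2]
    simp only [bivector]
    rw [mul_assoc, this]
    linear_combination ((h i k : ℂ) * (h j l : ℂ) * S i j * S k l / 2) * Complex.I_sq
  simp only [ipBiv, key, Finset.sum_sub_distrib, ← Finset.mul_sum, ipForm]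
  push_cast
  ring

end Forms

/-! ### Fields adapted to a null 2-form -/

/-- On the open set `U` of coordinates the fields `D` consist of smooth components, and
`L = ℓ ∧ e₂`, `*L = ℓ ∧ e₃` with `e₂`, `e₃` smooth orthonormal vector fields orthogonal to the
null vector field `ℓ`; moreover `𝓦 = 𝓛 ⊗ 𝓛`. -/
structure IsAdapted (D : Fields) (U : Set Pt) (e₂ e₃ : Pt → Fin 4 → ℝ) : Prop where
  metric : IsMetricOn D.g U
  smooth_l : ∀ i, ContDiffOn ℝ ∞ (fun y ↦ D.ℓ y i) U
  smooth_x : ∀ i, ContDiffOn ℝ ∞ (fun y ↦ D.x y i) U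
  smooth_e₂ : ∀ i, ContDiffOn ℝ ∞ (fun y ↦ e₂ y i) U
  smooth_e₃ : ∀ i, ContDiffOn ℝ ∞ (fun y ↦ e₃ y i) U
  screen : ∀ y ∈ U, IsScreen (ipBil (D.inv y)) (D.ℓ y) (e₂ y) (e₃ y) (D.x y)
  L_eq : ∀ y ∈ U, D.L y = wedge (D.ℓ y) (e₂ y)
  starL_eq : ∀ y ∈ U, D.starL y = wedge (D.ℓ y) (e₃ y)
  weyl_eq : ∀ y ∈ U, ∀ i j k l, weylSD D.g D.η y i j k l = D.bivL y i j * D.bivL y k l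

namespace IsMetricOn

variable {g : Pt → Fin 4 → Fin 4 → ℝ} {U : Set Pt} (hg : IsMetricOn g U)
include hg

/-- The metric, applied to two covectors, is their scalar product. -/
theorem app₂_metric {y : Pt} (hy : y ∈ U) (X Y : Fin 4 → ℝ) :
    app₂ (gInv g y) (g y) X Y = ip (gInv g y) X Y := by
  have h1 : app (gInv g y) (g y) Y = Y := by
    ext i
    simp only [app, raise, Finset.mul_sum]
    rw [Finset.sum_comm]
    simp only [← mul_assoc, ← Finset.sum_mul, hg.g_mul_inv hy]
    simp
  rw [app₂_eq_ip (hg.inv_symm y), h1]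

theorem raise_metric {y : Pt} (hy : y ∈ U) (i : Fin 4) :
    raise (gInv g y) (g y i) = Pi.single i 1 := by
  ext j
  rw [Pi.single_apply, raise, ← hg.inv_mul_g hy j i]
  exact Finset.sum_congr rfl fun k _ ↦ by rw [hg.symm y i k]

theorem ip_metric_left {y : Pt} (hy : y ∈ U) (i : Fin 4) (v : Fin 4 → ℝ) :
    ip (gInv g y) (g y i) v = v i := by
  rw [ip_comm (hg.inv_symm y), ip, hg.raise_metric hy]
  simp [Pi.single_apply]

theorem app₂_metric_left {y : Pt} (hy : y ∈ U) (i j : Fin 4) (B : Fin 4 → Fin 4 → ℝ) :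
    app₂ (gInv g y) B (g y i) (g y j) = B i j := by
  rw [app₂_eq_ip (hg.inv_symm y), hg.ip_metric_left hy, app, hg.raise_metric hy]
  simp [Pi.single_apply]

/-- A bilinear identity for all covectors is an identity between components. -/
theorem ext_form {y : Pt} (hy : y ∈ U) {B B' : Fin 4 → Fin 4 → ℝ}
    (h : ∀ X Y, app₂ (gInv g y) B X Y = app₂ (gInv g y) B' X Y) : B = B' := by
  funext i j
  rw [← hg.app₂_metric_left hy i j B, ← hg.app₂_metric_left hy i j B', h]

theorem ext_vec {y : Pt} (hy : y ∈ U) {v w : Fin 4 → ℝ}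
    (h : ∀ X, ip (gInv g y) X v = ip (gInv g y) X w) : v = w := by
  funext i
  rw [← hg.ip_metric_left hy i v, ← hg.ip_metric_left hy i w, h]

theorem ip_smooth {v w : Pt → Fin 4 → ℝ} (hv : ∀ j, ContDiffOn ℝ ∞ (fun y ↦ v y j) U)
    (hw : ∀ j, ContDiffOn ℝ ∞ (fun y ↦ w y j) U) :
    ContDiffOn ℝ ∞ (fun y ↦ ip (gInv g y) (v y) (w y)) U :=
  ContDiffOn.sum fun i _ ↦ (hv i).mul (ContDiffOn.sum fun j _ ↦ (hg.inv_smooth i j).mul (hw j))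

theorem raise_smooth {v : Pt → Fin 4 → ℝ} (hv : ∀ j, ContDiffOn ℝ ∞ (fun y ↦ v y j) U) (i : Fin 4) :
    ContDiffOn ℝ ∞ (fun y ↦ raise (gInv g y) (v y) i) U :=
  ContDiffOn.sum fun j _ ↦ (hg.inv_smooth i j).mul (hv j)

theorem app_smooth {B : Pt → Fin 4 → Fin 4 → ℝ} {v : Pt → Fin 4 → ℝ}
    (hB : ∀ i j, ContDiffOn ℝ ∞ (fun y ↦ B y i j) U)
    (hv : ∀ j, ContDiffOn ℝ ∞ (fun y ↦ v y j) U) (i : Fin 4) :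
    ContDiffOn ℝ ∞ (fun y ↦ app (gInv g y) (B y) (v y) i) U :=
  ContDiffOn.sum fun j _ ↦ (hB i j).mul (hg.raise_smooth hv j)

theorem app₂_smooth {B : Pt → Fin 4 → Fin 4 → ℝ} {v w : Pt → Fin 4 → ℝ}
    (hB : ∀ i j, ContDiffOn ℝ ∞ (fun y ↦ B y i j) U)
    (hv : ∀ j, ContDiffOn ℝ ∞ (fun y ↦ v y j) U) (hw : ∀ j, ContDiffOn ℝ ∞ (fun y ↦ w y j) U) :
    ContDiffOn ℝ ∞ (fun y ↦ app₂ (gInv g y) (B y) (v y) (w y)) U :=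
  ContDiffOn.sum fun i _ ↦ (hg.raise_smooth hv i).mul (hg.app_smooth hB hw i)

end IsMetricOn

namespace Fields

variable (D : Fields)

/-- The covariant derivative `∇_i ℓ_j`. -/
def T (y : Pt) : Fin 4 → Fin 4 → ℝ := cov₁ D.g D.ℓ y

/-- The covector field `u` in `∇ℓ = ℓ ⊗ u + w ⊗ ℓ`, normalized by `(u, x) = 0`. -/
def u (y : Pt) (j : Fin 4) : ℝ :=
  (1 / D.lx y) * (∑ i, raise (D.inv y) (D.x y) i * D.T y i j
    - app₂ (D.inv y) (D.T y) (D.x y) (D.x y) / D.lx y * D.ℓ y j)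

/-- The covector field `w` in `∇ℓ = ℓ ⊗ u + w ⊗ ℓ`. -/
def w (y : Pt) (i : Fin 4) : ℝ := app (D.inv y) (D.T y) (D.x y) i / D.lx y

/-- The covector field `q` in `Q = ℓ ⊗ q + q ⊗ ℓ`. -/
def q (y : Pt) (i : Fin 4) : ℝ :=
  (1 / D.lx y) * (app (D.inv y) (Q D.g y) (D.x y) i
    - app₂ (D.inv y) (Q D.g y) (D.x y) (D.x y) / (2 * D.lx y) * D.ℓ y i)

end Fields

namespace IsAdapted

variable {D : Fields} {U : Set Pt} {e₂ e₃ : Pt → Fin 4 → ℝ} (hD : IsAdapted D U e₂ e₃)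
include hD

theorem inv_symm (y : Pt) (i j : Fin 4) : D.inv y i j = D.inv y j i := hD.metric.inv_symm y i j

theorem lx_ne {y : Pt} (hy : y ∈ U) : D.lx y ≠ 0 := (hD.screen y hy).lx

theorem lx_smooth : ContDiffOn ℝ ∞ D.lx U := hD.metric.ip_smooth hD.smooth_l hD.smooth_x

theorem T_smooth (i j : Fin 4) : ContDiffOn ℝ ∞ (fun y ↦ D.T y i j) U :=
  hD.metric.cov₁_smooth hD.smooth_l i j

theorem u_smooth (j : Fin 4) : ContDiffOn ℝ ∞ (fun y ↦ D.u y j) U := by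
  refine (contDiffOn_const.div hD.lx_smooth fun y hy ↦ hD.lx_ne hy).mul (ContDiffOn.sub ?_ ?_)
  · exact ContDiffOn.sum fun i _ ↦ (hD.metric.raise_smooth hD.smooth_x i).mul (hD.T_smooth i j)
  · exact ((hD.metric.app₂_smooth hD.T_smooth hD.smooth_x hD.smooth_x).div hD.lx_smooth
      fun y hy ↦ hD.lx_ne hy).mul (hD.smooth_l j)

theorem w_smooth (j : Fin 4) : ContDiffOn ℝ ∞ (fun y ↦ D.w y j) U :=
  (hD.metric.app_smooth hD.T_smooth hD.smooth_x j).div hD.lx_smooth fun _ hy ↦ hD.lx_ne hy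

theorem q_smooth (i : Fin 4) : ContDiffOn ℝ ∞ (fun y ↦ D.q y i) U := by
  refine (contDiffOn_const.div hD.lx_smooth fun y hy ↦ hD.lx_ne hy).mul (ContDiffOn.sub ?_ ?_)
  · exact hD.metric.app_smooth hD.metric.Q_smooth hD.smooth_x i
  · exact ((hD.metric.app₂_smooth hD.metric.Q_smooth hD.smooth_x hD.smooth_x).div
      (contDiffOn_const.mul hD.lx_smooth)
      fun _ hy ↦ mul_ne_zero two_ne_zero (hD.lx_ne hy)).mul (hD.smooth_l i)

section Point

variable {y : Pt} (hy : y ∈ U)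
include hy

theorem T_l (i : Fin 4) : ip (D.inv y) (D.T y i) (D.ℓ y) = 0 := by
  have h1 := hD.metric.ip_cov_of_const hD.smooth_l hD.smooth_l (c := 0)
    (fun z hz ↦ (hD.screen z hz).ll) hy i
  rw [ip_comm (hD.metric.inv_symm y) (D.ℓ y)] at h1
  change ip (gInv D.g y) (cov₁ D.g D.ℓ y i) (D.ℓ y) = 0
  linarith

theorem l_cov_e₂ (i : Fin 4) :
    ip (D.inv y) (D.ℓ y) (cov₁ D.g e₂ y i) = -ip (D.inv y) (D.T y i) (e₂ y) := by
  have h1 := hD.metric.ip_cov_of_const hD.smooth_l hD.smooth_e₂ (c := 0)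
    (fun z hz ↦ (hD.screen z hz).l2) hy i
  change ip (gInv D.g y) _ _ = -ip (gInv D.g y) (cov₁ D.g D.ℓ y i) (e₂ y)
  linarith

theorem l_cov_e₃ (i : Fin 4) :
    ip (D.inv y) (D.ℓ y) (cov₁ D.g e₃ y i) = -ip (D.inv y) (D.T y i) (e₃ y) := by
  have h1 := hD.metric.ip_cov_of_const hD.smooth_l hD.smooth_e₃ (c := 0)
    (fun z hz ↦ (hD.screen z hz).l3) hy i
  change ip (gInv D.g y) _ _ = -ip (gInv D.g y) (cov₁ D.g D.ℓ y i) (e₃ y)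
  linarith

theorem cov₂_L (i : Fin 4) : cov₂ D.g D.L y i =
    wedge (D.T y i) (e₂ y) + wedge (D.ℓ y) (cov₁ D.g e₂ y i) := by
  funext j k
  rw [hD.metric.cov₂_congr hD.L_eq hy, hD.metric.cov₂_wedge hD.smooth_l hD.smooth_e₂ hy]
  rfl

theorem cov₂_starL (i : Fin 4) : cov₂ D.g D.starL y i =
    wedge (D.T y i) (e₃ y) + wedge (D.ℓ y) (cov₁ D.g e₃ y i) := by
  funext j k
  rw [hD.metric.cov₂_congr hD.starL_eq hy, hD.metric.cov₂_wedge hD.smooth_l hD.smooth_e₃ hy]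
  rfl

omit hD hy in
theorem app_app_wedge (h : Matrix (Fin 4) (Fin 4) ℝ) (a b c d v x : Fin 4 → ℝ) :
    ∑ j, app h (wedge a b + wedge c d) v j * raise h x j =
      ip h a x * ip h b v - ip h b x * ip h a v + ip h c x * ip h d v - ip h d x * ip h c v := by
  have key : ∀ j, app h (wedge a b + wedge c d) v j =
      a j * ip h b v - b j * ip h a v + c j * ip h d v - d j * ip h c v := by
    intro j
    simp only [app, ip, wedge, Pi.add_apply, Finset.mul_sum, ← Finset.sum_add_distrib,
      ← Finset.sum_sub_distrib]
    exact Finset.sum_congr rfl fun _ _ ↦ by ring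
  simp only [key]
  simp only [ip, Finset.sum_mul, ← Finset.sum_add_distrib, ← Finset.sum_sub_distrib]
  exact Finset.sum_congr rfl fun _ _ ↦ by ring

theorem a_eq : D.a y = app (D.inv y) (D.T y) (e₂ y) := by
  have hs := hD.screen y hy
  have hll : ip (D.inv y) (D.ℓ y) (D.ℓ y) = 0 := hs.ll
  have hl2 : ip (D.inv y) (e₂ y) (D.ℓ y) = 0 := by rw [← ipBil_apply, hs.symm]; exact hs.l2
  have hlx : ip (D.inv y) (D.ℓ y) (D.x y) ≠ 0 := hs.lx
  funext i
  rw [Fields.a, app]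
  simp only [hD.cov₂_L hy]
  rw [app_app_wedge, hll, hl2, hD.T_l hy, ip_comm (hD.inv_symm y) (cov₁ D.g e₂ y i) (D.ℓ y), hD.l_cov_e₂ hy,
    Fields.lx]
  field_simp
  simp [ip, app]

theorem aStar_eq : D.aStar y = -app (D.inv y) (D.T y) (e₃ y) := by
  have hs := hD.screen y hy
  have hll : ip (D.inv y) (D.ℓ y) (D.ℓ y) = 0 := hs.ll
  have hl2 : ip (D.inv y) (e₃ y) (D.ℓ y) = 0 := by rw [← ipBil_apply, hs.symm]; exact hs.l3
  have hlx : ip (D.inv y) (D.ℓ y) (D.x y) ≠ 0 := hs.lx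
  funext i
  rw [Fields.aStar, app]
  simp only [hD.cov₂_starL hy]
  rw [app_app_wedge, hll, hl2, hD.T_l hy, ip_comm (hD.inv_symm y) (cov₁ D.g e₃ y i) (D.ℓ y), hD.l_cov_e₃ hy,
    Fields.lx]
  field_simp
  simp [ip, app]

/-- `∇_v 𝓛` is a null bivector only if `∇_v ℓ` is orthogonal to `e₂` and `e₃`: the square of
`∇_v 𝓛` is `(p₃² - p₂²) + 2 i p₂ p₃` with `p_k = (∇_v ℓ, e_k)`. -/
theorem covBivL_null {v : Fin 4 → ℝ}
    (h0 : ipBiv (D.inv y) (D.covBivL v y) (D.covBivL v y) = 0) :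
    app₂ (D.inv y) (D.T y) v (e₂ y) = 0 ∧ app₂ (D.inv y) (D.T y) v (e₃ y) = 0 := by
  have hs := hD.screen y hy
  have hsymm := hs.symm
  simp only [ipBil_apply] at hsymm
  set h := D.inv y with hh
  set p : Fin 4 → ℝ := fun j ↦ ∑ i, raise h v i * D.T y i j with hp
  have hcon : ∀ (B : Fin 4 → Fin 4 → ℝ) (X : Fin 4 → ℝ),
      ip h (fun j ↦ ∑ i, raise h v i * B i j) X = app₂ h B v X := fun B X ↦ ip_contract v B X
  have hsum : ∀ (c : Fin 4 → Fin 4 → ℝ) (e : Fin 4 → ℝ),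
      (fun j k ↦ ∑ i, raise h v i * (wedge (D.T y i) e + wedge (D.ℓ y) (c i)) j k)
        = wedge p e + wedge (D.ℓ y) (fun j ↦ ∑ i, raise h v i * c i j) := by
    intro c e
    funext j k
    simp only [hp, wedge, Pi.add_apply, Finset.mul_sum, Finset.sum_mul, ← Finset.sum_add_distrib,
      ← Finset.sum_sub_distrib]
    exact Finset.sum_congr rfl fun _ _ ↦ by ring
  set r₂ : Fin 4 → ℝ := fun j ↦ ∑ i, raise h v i * cov₁ D.g e₂ y i j with hr₂
  set r₃ : Fin 4 → ℝ := fun j ↦ ∑ i, raise h v i * cov₁ D.g e₃ y i j with hr₃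
  have hcb : D.covBivL v y = bivector (wedge p (e₂ y) + wedge (D.ℓ y) r₂)
      (wedge p (e₃ y) + wedge (D.ℓ y) r₃) := by
    rw [Fields.covBivL, ← hsum, ← hsum]
    congr 1
    · funext j k
      exact Finset.sum_congr rfl fun i _ ↦ by rw [hD.cov₂_L hy]
    · funext j k
      exact Finset.sum_congr rfl fun i _ ↦ by rw [hD.cov₂_starL hy]
  have hpl : ip h (D.ℓ y) p = 0 := by
    rw [hsymm, hcon, app₂_eq_sum]
    exact Finset.sum_eq_zero fun i _ ↦ by
      rw [show ip h (D.T y i) (D.ℓ y) = 0 from hD.T_l hy i, mul_zero]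
  have hr2 : ip h (D.ℓ y) r₂ = -ip h p (e₂ y) := by
    rw [hsymm, hcon, hcon, app₂_eq_sum, app₂_eq_sum, ← Finset.sum_neg_distrib]
    refine Finset.sum_congr rfl fun i _ ↦ ?_
    rw [hsymm, show ip h (D.ℓ y) (cov₁ D.g e₂ y i) = _ from hD.l_cov_e₂ hy i, mul_neg]
  have hr3 : ip h (D.ℓ y) r₃ = -ip h p (e₃ y) := by
    rw [hsymm, hcon, hcon, app₂_eq_sum, app₂_eq_sum, ← Finset.sum_neg_distrib]
    refine Finset.sum_congr rfl fun i _ ↦ ?_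
    rw [hsymm, show ip h (D.ℓ y) (cov₁ D.g e₃ y i) = _ from hD.l_cov_e₃ hy i, mul_neg]
  have hpp : ip h p p = ip h p (e₂ y) ^ 2 + ip h p (e₃ y) ^ 2 := by
    have := hs.inner_eq hpl hpl
    simp only [ipBil_apply] at this
    rw [this, hsymm (e₂ y), hsymm (e₃ y)]; ring
  have hll : ip h (D.ℓ y) (D.ℓ y) = 0 := hs.ll
  have hl2 : ip h (D.ℓ y) (e₂ y) = 0 := hs.l2
  have hl3 : ip h (D.ℓ y) (e₃ y) = 0 := hs.l3
  have h22 : ip h (e₂ y) (e₂ y) = 1 := hs.e22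
  have h33 : ip h (e₃ y) (e₃ y) = 1 := hs.e33
  have h23 : ip h (e₂ y) (e₃ y) = 0 := hs.e23
  rw [hcb, ipBiv_bivector] at h0
  simp only [ipForm_add_left, ipForm_add_right, ipForm_wedge, hsymm p (D.ℓ y), hsymm r₂ (D.ℓ y),
    hsymm r₃ (D.ℓ y), hsymm (e₂ y) (D.ℓ y), hsymm (e₃ y) (D.ℓ y), hsymm (e₂ y) p, hsymm (e₃ y) p,
    hsymm (e₃ y) (e₂ y), hpl, hr2, hr3, hpp, hll, hl2, hl3, h22, h33, h23] at h0
  have hre := congrArg Complex.re h0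
  have him := congrArg Complex.im h0
  simp only [Complex.sub_re, Complex.sub_im, Complex.ofReal_re, Complex.ofReal_im, Complex.I_mul_re,
    Complex.I_mul_im, Complex.zero_re, Complex.zero_im] at hre him
  rw [← hcon, ← hcon]
  change ip h p (e₂ y) = 0 ∧ ip h p (e₃ y) = 0
  have e1 : ip h p (e₂ y) * ip h p (e₃ y) = 0 := by linarith
  have e2 : ip h p (e₂ y) ^ 2 = ip h p (e₃ y) ^ 2 := by linarith
  rcases mul_eq_zero.1 e1 with h | h
  · refine ⟨h, ?_⟩
    rw [h] at e2
    exact pow_eq_zero_iff two_ne_zero |>.1 (by linarith)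
  · refine ⟨?_, h⟩
    rw [h] at e2
    exact pow_eq_zero_iff two_ne_zero |>.1 (by linarith)

end Point

end IsAdapted

/-! ### The Ricci identity for the fundamental vector -/

/-- Contraction of a tensor identity of the shape of the Ricci identity for `ℓ` with three
vectors. -/
theorem star_contract {l u q : Fin 4 → ℝ} {Du dw G Q : Fin 4 → Fin 4 → ℝ}
    (h : ∀ c d b, (l c * u d - u c * l d) * u b + l d * Du c b - l c * Du d b + dw c d * l b
      = G c b * q d - G d b * q c - l c * Q d b + l d * Q c b) (X Y Z : Fin 4 → ℝ) :
    ((∑ i, l i * X i) * (∑ i, u i * Y i) - (∑ i, u i * X i) * (∑ i, l i * Y i)) * (∑ i, u i * Z i)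
      + (∑ i, l i * Y i) * (∑ i, X i * ∑ j, Du i j * Z j)
      - (∑ i, l i * X i) * (∑ i, Y i * ∑ j, Du i j * Z j)
      + (∑ i, X i * ∑ j, dw i j * Y j) * (∑ i, l i * Z i)
    = (∑ i, X i * ∑ j, G i j * Z j) * (∑ i, Y i * q i)
      - (∑ i, Y i * ∑ j, G i j * Z j) * (∑ i, X i * q i)
      - (∑ i, l i * X i) * (∑ i, Y i * ∑ j, Q i j * Z j)
      + (∑ i, l i * Y i) * (∑ i, X i * ∑ j, Q i j * Z j) := by
  have key : ∀ c d, (l c * u d - u c * l d) * (∑ i, u i * Z i) + l d * (∑ j, Du c j * Z j)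
      - l c * (∑ j, Du d j * Z j) + dw c d * (∑ i, l i * Z i)
      = (∑ j, G c j * Z j) * q d - (∑ j, G d j * Z j) * q c - l c * (∑ j, Q d j * Z j)
        + l d * (∑ j, Q c j * Z j) := by
    intro c d
    have := Finset.sum_congr rfl
      (fun b (_ : b ∈ (Finset.univ : Finset (Fin 4))) ↦ congrArg (· * Z b) (h c d b))
    simp only [Fin.sum_univ_four] at this ⊢
    linear_combination this
  obtain ⟨DZ, hDZ⟩ : ∃ f : Fin 4 → ℝ, ∀ i, ∑ j, Du i j * Z j = f i := ⟨_, fun _ ↦ rfl⟩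
  obtain ⟨GZ, hGZ⟩ : ∃ f : Fin 4 → ℝ, ∀ i, ∑ j, G i j * Z j = f i := ⟨_, fun _ ↦ rfl⟩
  obtain ⟨QZ, hQZ⟩ : ∃ f : Fin 4 → ℝ, ∀ i, ∑ j, Q i j * Z j = f i := ⟨_, fun _ ↦ rfl⟩
  generalize (∑ i, u i * Z i) = uZ at key ⊢
  generalize (∑ i, l i * Z i) = lZ at key ⊢
  simp only [hDZ, hGZ, hQZ] at key ⊢
  have := Finset.sum_congr rfl (fun c (_ : c ∈ (Finset.univ : Finset (Fin 4))) ↦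
    congrArg (X c * ·) (Finset.sum_congr rfl (fun d (_ : d ∈ (Finset.univ : Finset (Fin 4))) ↦
      congrArg (Y d * ·) (key c d))))
  simp only [Fin.sum_univ_four] at this ⊢
  linear_combination this

namespace IsAdapted

variable {D : Fields} {U : Set Pt} {e₂ e₃ : Pt → Fin 4 → ℝ} (hD : IsAdapted D U e₂ e₃)
include hD

section Point

variable {y : Pt} (hy : y ∈ U)
include hy

/-- The concomitants `a` and `a*` are proportional to `ℓ`: `φ₁ = 0` makes them orthogonal to `ℓ`,
and `φ₂ = 0` makes them null. -/
theorem a_eq_smul (h1 : D.phi1 y = 0) (h2 : D.phi2 y = 0) :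
    D.a y = D.alpha y • D.ℓ y ∧ D.aStar y = D.alphaStar y • D.ℓ y := by
  have hs := hD.screen y hy
  obtain ⟨hl2, hl3⟩ := hD.covBivL_null hy h1
  have hn1 := norm_nonneg (ipBiv (D.inv y) (D.covBivL (D.a y) y) (D.covBivL (D.a y) y))
  have hn2 := norm_nonneg (ipBiv (D.inv y) (D.covBivL (D.aStar y) y) (D.covBivL (D.aStar y) y))
  rw [Fields.phi2] at h2
  have haa := (hD.covBivL_null hy (norm_eq_zero.1 (by linarith :
    ‖ipBiv (D.inv y) (D.covBivL (D.a y) y) (D.covBivL (D.a y) y)‖ = 0))).1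
  have hbb := (hD.covBivL_null hy (norm_eq_zero.1 (by linarith :
    ‖ipBiv (D.inv y) (D.covBivL (D.aStar y) y) (D.covBivL (D.aStar y) y)‖ = 0))).2
  have h3 : app (D.inv y) (D.T y) (e₃ y) = -D.aStar y := by rw [hD.aStar_eq hy, neg_neg]
  rw [app₂_eq_ip (hD.inv_symm y)] at hl2 hl3 haa hbb
  rw [← hD.a_eq hy] at hl2 haa
  rw [h3, ← ipBil_apply, map_neg, neg_eq_zero] at hl3 hbb
  exact ⟨hs.eq_smul_of_null hl2 haa, hs.eq_smul_of_null hl3 hbb⟩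

theorem T_app_l (X : Fin 4 → ℝ) : app₂ (D.inv y) (D.T y) X (D.ℓ y) = 0 := by
  rw [app₂_eq_sum]
  exact Finset.sum_eq_zero fun i _ ↦ by rw [hD.T_l hy i, mul_zero]

theorem T_app_e₂ (h1 : D.phi1 y = 0) (h2 : D.phi2 y = 0) (X : Fin 4 → ℝ) :
    app₂ (D.inv y) (D.T y) X (e₂ y) = D.alpha y * ip (D.inv y) (D.ℓ y) X := by
  rw [app₂_eq_ip (hD.inv_symm y), ← hD.a_eq hy, (hD.a_eq_smul hy h1 h2).1, ← ipBil_apply, map_smul,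
    (hD.screen y hy).symm]
  rfl

theorem T_app_e₃ (h1 : D.phi1 y = 0) (h2 : D.phi2 y = 0) (X : Fin 4 → ℝ) :
    app₂ (D.inv y) (D.T y) X (e₃ y) = -D.alphaStar y * ip (D.inv y) (D.ℓ y) X := by
  have h3 : app (D.inv y) (D.T y) (e₃ y) = -D.aStar y := by rw [hD.aStar_eq hy, neg_neg]
  rw [app₂_eq_ip (hD.inv_symm y), h3, (hD.a_eq_smul hy h1 h2).2, ← ipBil_apply, map_neg, map_smul,
    (hD.screen y hy).symm, smul_eq_mul, neg_mul]
  rfl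

omit hD hy in
theorem ip_u (X : Fin 4 → ℝ) : ip (D.inv y) (D.u y) X =
    (app₂ (D.inv y) (D.T y) (D.x y) X
      - app₂ (D.inv y) (D.T y) (D.x y) (D.x y) / D.lx y * ip (D.inv y) (D.ℓ y) X) / D.lx y := by
  have : D.u y = fun j ↦ (1 / D.lx y) * ((fun j ↦ ∑ i, raise (D.inv y) (D.x y) i * D.T y i j) j
    - app₂ (D.inv y) (D.T y) (D.x y) (D.x y) / D.lx y * D.ℓ y j) := rfl
  rw [this, ip_lin_comb, ip_contract]
  ring

omit hy in
theorem ip_w (X : Fin 4 → ℝ) : ip (D.inv y) (D.w y) X =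
    app₂ (D.inv y) (D.T y) X (D.x y) / D.lx y := by
  rw [app₂_eq_ip (hD.inv_symm y), ip_comm (hD.inv_symm y) X]
  simp only [ip, Fields.w, Finset.sum_div]
  exact Finset.sum_congr rfl fun _ _ ↦ by ring

/-- The conditions `φ₁ = φ₂ = 0` say that `∇ℓ = ℓ ⊗ u + w ⊗ ℓ`. -/
theorem T_eq (h1 : D.phi1 y = 0) (h2 : D.phi2 y = 0) :
    D.T y = fun i j ↦ D.ℓ y i * D.u y j + D.w y i * D.ℓ y j := by
  refine hD.metric.ext_form hy fun X Y ↦ ?_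
  rw [app₂_add, app₂_tmul, app₂_tmul]
  have := (hD.screen y hy).grad_decomp (T := appForm (D.inv y) (D.T y)) (hD.T_app_l hy)
    (hD.T_app_e₂ hy h1 h2) (hD.T_app_e₃ hy h1 h2) X Y
  have h3 := ip_u (D := D) (y := y) Y
  have h4 := hD.ip_w (y := y) X
  simp only [Fields.inv] at h3 h4
  rw [h3, h4]
  exact this

theorem b_eq (h1 : D.phi1 y = 0) (h2 : D.phi2 y = 0) : D.b y = fun i ↦ D.u y i + D.w y i := by
  have hlx := hD.lx_ne hy
  have hB : ∀ i, app (D.inv y) (D.B y) (D.x y) i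
      = D.ℓ y i * (ip (D.inv y) (D.u y) (D.x y) + ip (D.inv y) (D.w y) (D.x y))
        + (D.u y i + D.w y i) * D.lx y := by
    intro i
    have hBij : ∀ j, D.B y i j = D.T y i j + D.T y j i := fun j ↦ rfl
    simp only [app, hBij, hD.T_eq hy h1 h2, Fields.lx, ip, Finset.mul_sum,
      ← Finset.sum_add_distrib]
    exact Finset.sum_congr rfl fun _ _ ↦ by ring
  have hBx : app₂ (D.inv y) (D.B y) (D.x y) (D.x y)
      = 2 * D.lx y * (ip (D.inv y) (D.u y) (D.x y) + ip (D.inv y) (D.w y) (D.x y)) := by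
    have h3 : app (D.inv y) (D.B y) (D.x y)
      = (ip (D.inv y) (D.u y) (D.x y) + ip (D.inv y) (D.w y) (D.x y)) • D.ℓ y
        + D.lx y • (D.u y + D.w y) := by
      funext i; rw [hB]; simp; ring
    rw [app₂_eq_ip (hD.inv_symm y), h3]
    have hsymm := (hD.screen y hy).symm
    simp only [← ipBil_apply, map_add, map_smul, smul_eq_mul, hsymm (D.x y), LinearMap.add_apply,
      LinearMap.smul_apply]
    simp only [ipBil_apply, Fields.lx]
    ring
  funext i
  rw [Fields.b, hB, hBx]
  field_simp
  ring

omit hD in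
theorem weyl_eq_real (hD : IsAdapted D U e₂ e₃) (a b c d : Fin 4) :
    weyl D.g y a b c d = D.L y a b * D.L y c d - D.starL y a b * D.starL y c d := by
  have h2 : (Real.sqrt 2 : ℂ) * (Real.sqrt 2 : ℂ) = 2 := by
    rw [← Complex.ofReal_mul, Real.mul_self_sqrt (by norm_num)]; norm_num
  have h := hD.weyl_eq y hy a b c d
  simp only [weylSD, Fields.bivL, bivector] at h
  rw [div_mul_div_comm, h2] at h
  have hre := congrArg Complex.re h
  simp at hre
  linarith

theorem riemann_antisymm (a b c d : Fin 4) :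
    riemann D.g y a b c d = -riemann D.g y b a c d := by
  have h1 := weyl_eq_real hy hD a b c d
  have h2 := weyl_eq_real hy hD b a c d
  rw [hD.L_eq y hy, hD.starL_eq y hy, weyl] at h1 h2
  simp only [wedge] at h1 h2
  linear_combination h1 + h2

theorem Q_symm (i j : Fin 4) : Q D.g y i j = Q D.g y j i := by
  rw [Q, Q, hD.metric.ricci_symm hy (hD.riemann_antisymm hy), hD.metric.symm]

/-- Only the Ricci part of the curvature acts on the fundamental vector. -/
theorem riemann_l (b c d : Fin 4) : ∑ a, riemannUp D.g y a b c d * D.ℓ y a =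
    D.ℓ y c * Q D.g y b d - D.ℓ y d * Q D.g y b c
      + D.g y b d * app (D.inv y) (Q D.g y) (D.ℓ y) c
      - D.g y b c * app (D.inv y) (Q D.g y) (D.ℓ y) d := by
  have hs := hD.screen y hy
  have hll : ip (D.inv y) (D.ℓ y) (D.ℓ y) = 0 := hs.ll
  have hl2 : ip (D.inv y) (e₂ y) (D.ℓ y) = 0 := by rw [← ipBil_apply, hs.symm]; exact hs.l2
  have hl3 : ip (D.inv y) (e₃ y) (D.ℓ y) = 0 := by rw [← ipBil_apply, hs.symm]; exact hs.l3
  have h1 : ∑ a, riemannUp D.g y a b c d * D.ℓ y a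
      = ∑ e, riemann D.g y e b c d * raise (D.inv y) (D.ℓ y) e := by
    simp only [hD.metric.riemannUp_eq hy, raise, Finset.mul_sum, Finset.sum_mul]
    rw [Finset.sum_comm]
    refine Finset.sum_congr rfl fun e _ ↦ Finset.sum_congr rfl fun a _ ↦ ?_
    rw [hD.inv_symm y e a]
    change gInv D.g y a e * _ * _ = _ * (gInv D.g y a e * _)
    ring
  have hw : ∀ v : Fin 4 → ℝ, ip (D.inv y) v (D.ℓ y) = 0 →
      ∑ e, wedge (D.ℓ y) v e b * raise (D.inv y) (D.ℓ y) e = 0 := by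
    intro v hv
    have : ∑ e, wedge (D.ℓ y) v e b * raise (D.inv y) (D.ℓ y) e
        = v b * ip (D.inv y) (D.ℓ y) (D.ℓ y) - D.ℓ y b * ip (D.inv y) v (D.ℓ y) := by
      simp only [ip, wedge, Finset.mul_sum, ← Finset.sum_sub_distrib]
      exact Finset.sum_congr rfl fun _ _ ↦ by ring
    rw [this, hll, hv]; ring
  have hg : ∀ c, ∑ e, D.g y e c * raise (D.inv y) (D.ℓ y) e = D.ℓ y c := by
    intro c
    rw [← hD.metric.ip_metric_left hy c (D.ℓ y)]
    exact Finset.sum_congr rfl fun e _ ↦ by rw [hD.metric.symm]; rfl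
  have hQ : ∀ c, ∑ e, Q D.g y e c * raise (D.inv y) (D.ℓ y) e
      = app (D.inv y) (Q D.g y) (D.ℓ y) c := fun c ↦
    Finset.sum_congr rfl fun e _ ↦ by rw [hD.Q_symm hy]
  have hR : ∀ e, riemann D.g y e b c d * raise (D.inv y) (D.ℓ y) e
      = (wedge (D.ℓ y) (e₂ y) e b * raise (D.inv y) (D.ℓ y) e) * D.L y c d
        - (wedge (D.ℓ y) (e₃ y) e b * raise (D.inv y) (D.ℓ y) e) * D.starL y c d
        + (D.g y e c * raise (D.inv y) (D.ℓ y) e) * Q D.g y b d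
        - (D.g y e d * raise (D.inv y) (D.ℓ y) e) * Q D.g y b c
        + (Q D.g y e c * raise (D.inv y) (D.ℓ y) e) * D.g y b d
        - (Q D.g y e d * raise (D.inv y) (D.ℓ y) e) * D.g y b c := by
    intro e
    have := weyl_eq_real hy hD e b c d
    rw [← hD.L_eq y hy, ← hD.starL_eq y hy]
    rw [weyl] at this
    linear_combination (raise (D.inv y) (D.ℓ y) e) * this
  rw [h1]
  simp only [hR, Finset.sum_add_distrib, Finset.sum_sub_distrib, ← Finset.sum_mul, hg, hQ,
    hw _ hl2, hw _ hl3]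
  ring

theorem Q_form_symm (X Y : Fin 4 → ℝ) :
    appForm (D.inv y) (Q D.g y) X Y = appForm (D.inv y) (Q D.g y) Y X := by
  rw [appForm_apply, appForm_apply, ← app₂_swap]
  congr 1
  funext i j
  exact hD.Q_symm hy j i

theorem ip_u_l : ip (D.inv y) (D.u y) (D.ℓ y) = 0 := by
  have hll : ip (D.inv y) (D.ℓ y) (D.ℓ y) = 0 := (hD.screen y hy).ll
  rw [ip_u, hD.T_app_l hy, hll]; simp

end Point

section Family

variable (h1 : ∀ y ∈ U, D.phi1 y = 0) (h2 : ∀ y ∈ U, D.phi2 y = 0) {y : Pt} (hy : y ∈ U)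
include h1 h2 hy

/-- The Ricci identity for `ℓ` in terms of `u` and `w`, in components. -/
theorem ricci_identity_l (c d b : Fin 4) :
    (D.ℓ y c * D.u y d - D.u y c * D.ℓ y d) * D.u y b + D.ℓ y d * cov₁ D.g D.u y c b
      - D.ℓ y c * cov₁ D.g D.u y d b + extD D.w y c d * D.ℓ y b
    = D.g y c b * app (D.inv y) (Q D.g y) (D.ℓ y) d - D.g y d b * app (D.inv y) (Q D.g y) (D.ℓ y) c
      - D.ℓ y c * Q D.g y d b + D.ℓ y d * Q D.g y c b := by
  have hcov : ∀ c d, cov₂ D.g (cov₁ D.g D.ℓ) y c d b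
      = D.T y c d * D.u y b + D.ℓ y d * cov₁ D.g D.u y c b
        + (cov₁ D.g D.w y c d * D.ℓ y b + D.w y d * D.T y c b) := by
    intro c d
    rw [hD.metric.cov₂_congr (S := cov₁ D.g D.ℓ)
      (T := fun z i j ↦ D.ℓ z i * D.u z j + D.w z i * D.ℓ z j)
      (fun z hz ↦ hD.T_eq hz (h1 z hz) (h2 z hz)) hy,
      hD.metric.cov₂_add (fun j k ↦ (hD.smooth_l j).mul (hD.u_smooth k))
        (fun j k ↦ (hD.w_smooth j).mul (hD.smooth_l k)) hy,
      hD.metric.cov₂_tmul hD.smooth_l hD.u_smooth hy, hD.metric.cov₂_tmul hD.w_smooth hD.smooth_l hy]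
    rfl
  have hR := hD.metric.ricci_identity hD.smooth_l hy b c d
  rw [hcov, hcov, hD.riemann_l hy] at hR
  simp only [hD.T_eq hy (h1 y hy) (h2 y hy)] at hR
  rw [hD.metric.extD_eq]
  rw [hD.Q_symm hy b d, hD.Q_symm hy b c, hD.metric.symm y b d, hD.metric.symm y b c] at hR
  linear_combination hR

/-- The Ricci identity for `ℓ` in terms of `u` and `w`. -/
theorem ricci_identity_forms (X Y Z : Fin 4 → ℝ) :
    (ipBil (D.inv y) (D.ℓ y) X * ipBil (D.inv y) (D.u y) Y
      - ipBil (D.inv y) (D.u y) X * ipBil (D.inv y) (D.ℓ y) Y) * ipBil (D.inv y) (D.u y) Z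
    + ipBil (D.inv y) (D.ℓ y) Y * appForm (D.inv y) (cov₁ D.g D.u y) X Z
    - ipBil (D.inv y) (D.ℓ y) X * appForm (D.inv y) (cov₁ D.g D.u y) Y Z
    + appForm (D.inv y) (extD D.w y) X Y * ipBil (D.inv y) (D.ℓ y) Z
    = ipBil (D.inv y) X Z * appForm (D.inv y) (Q D.g y) (D.ℓ y) Y
      - ipBil (D.inv y) Y Z * appForm (D.inv y) (Q D.g y) (D.ℓ y) X
      - ipBil (D.inv y) (D.ℓ y) X * appForm (D.inv y) (Q D.g y) Y Z
      + ipBil (D.inv y) (D.ℓ y) Y * appForm (D.inv y) (Q D.g y) X Z := by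
  have := star_contract (hD.ricci_identity_l h1 h2 hy) (raise (D.inv y) X) (raise (D.inv y) Y)
    (raise (D.inv y) Z)
  have hQ : ∀ Y, appForm (D.inv y) (Q D.g y) (D.ℓ y) Y
      = ∑ i, raise (D.inv y) Y i * app (D.inv y) (Q D.g y) (D.ℓ y) i := by
    intro Y
    rw [appForm_apply, ← app₂_swap]
    exact Finset.sum_congr rfl fun i _ ↦ congrArg _ (Finset.sum_congr rfl fun j _ ↦ by
      rw [hD.Q_symm hy])
  rw [hQ, hQ]
  have hG : ∀ X, ipBil (D.inv y) X Z = app₂ (D.inv y) (D.g y) X Z := fun X ↦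
    (hD.metric.app₂_metric hy X Z).symm
  rw [hG X, hG Y]
  exact this

/-- The fundamental vector is an eigenvector of `Q`. -/
theorem app_Q_l (i : Fin 4) : app (D.inv y) (Q D.g y) (D.ℓ y) i = D.lam y * D.ℓ y i := by
  have key : app (D.inv y) (Q D.g y) (D.ℓ y) = D.lam y • D.ℓ y := by
    refine hD.metric.ext_vec hy fun X ↦ ?_
    have h3 := (hD.screen y hy).eigen (hD.ricci_identity_forms h1 h2 hy) X
    rw [hD.Q_form_symm hy, appForm_apply, app₂_eq_ip (hD.inv_symm y)] at h3
    change ip (D.inv y) _ _ = ipBil (D.inv y) _ _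
    rw [h3, map_smul, (hD.screen y hy).symm X]
    rfl
  rw [key]; rfl

theorem ip_u_u : ip (D.inv y) (D.u y) (D.u y) = D.alpha y ^ 2 + D.alphaStar y ^ 2 := by
  have hs := hD.screen y hy
  have hlx := hD.lx_ne hy
  have hl2 : ip (D.inv y) (D.ℓ y) (e₂ y) = 0 := hs.l2
  have hl3 : ip (D.inv y) (D.ℓ y) (e₃ y) = 0 := hs.l3
  have hul : ipBil (D.inv y) (D.ℓ y) (D.u y) = 0 := by
    rw [hs.symm]; exact hD.ip_u_l hy
  have h := hs.inner_eq hul hul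
  rw [hs.symm (e₂ y), hs.symm (e₃ y)] at h
  simp only [ipBil_apply] at h
  have h4 : ip (D.inv y) (D.ℓ y) (D.x y) = D.lx y := rfl
  rw [h, ip_u (e₂ y), ip_u (e₃ y), hl2, hl3, hD.T_app_e₂ hy (h1 y hy) (h2 y hy),
    hD.T_app_e₃ hy (h1 y hy) (h2 y hy), h4]
  field_simp
  ring

/-- The form `b` equals `u + w`, so its exterior derivative is `du + dw`. -/
theorem extD_b : extD D.b y =
    fun i j ↦ cov₁ D.g D.u y i j - cov₁ D.g D.u y j i + extD D.w y i j := by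
  funext i j
  have hu := fun j ↦ diffAt_of_contDiffOn hD.metric.isOpen (hD.u_smooth j) hy
  have hw := fun j ↦ diffAt_of_contDiffOn hD.metric.isOpen (hD.w_smooth j) hy
  have hb : ∀ i j, pd i (fun z ↦ D.b z j) y = pd i (fun z ↦ D.u z j) y + pd i (fun z ↦ D.w z j) y := by
    intro i j
    rw [pd_congr hD.metric.isOpen
      (fun z hz ↦ congrFun (hD.b_eq hz (h1 z hz) (h2 z hz)) j) hy, pd_add (hu j) (hw j)]
  rw [← hD.metric.extD_eq]
  simp only [extD, hb]
  ring

/-- The vanishing of `(db, db)` relates the eigenvalue `λ` to `α` and `α*`. -/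
theorem lam_eq (h5 : D.phi5 y = 0) : 2 * D.lam y + D.alpha y ^ 2 + D.alphaStar y ^ 2 = 0 := by
  have hs := hD.screen y hy
  have hlx := hD.lx_ne hy
  have star := hD.ricci_identity_forms h1 h2 hy
  have hul := hD.ip_u_l hy
  set h := D.inv y with hh
  have hF : ∀ X Y, appForm h (extD D.b y) X Y = appForm h (cov₁ D.g D.u y) X Y
      - appForm h (cov₁ D.g D.u y) Y X + appForm h (extD D.w y) X Y := by
    intro X Y
    simp only [appForm_apply]
    rw [hD.extD_b h1 h2 hy, app₂_add, app₂_sub, app₂_swap (cov₁ D.g D.u y)]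
  have hanti : ∀ X Y, appForm h (extD D.b y) X Y = -appForm h (extD D.b y) Y X := by
    intro X Y
    simp only [appForm_apply]
    rw [← app₂_swap]
    simp only [app₂, app, extD, ← Finset.sum_neg_distrib, ← mul_neg]
    exact Finset.sum_congr rfl fun _ _ ↦ congrArg _ (Finset.sum_congr rfl fun _ _ ↦ by ring)
  have hperp : ∀ X Y, ipBil h (D.ℓ y) X = 0 → ipBil h (D.ℓ y) Y = 0 →
      appForm h (extD D.b y) X Y = 0 := by
    intro X Y hX hY
    rw [hF]
    exact hs.db_perp (hD.Q_form_symm hy) star hX hY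
  -- hence `db = ℓ ∧ z`, and `(db, db) = -(ℓ, z)²`
  set z : Fin 4 → ℝ := fun j ↦ ∑ i, raise h ((1 / D.lx y) • D.x y) i * extD D.b y i j with hz
  have hzX : ∀ X, ip h z X = appForm h (extD D.b y) (D.x y) X / D.lx y := by
    intro X
    rw [hz, ip_contract, ← appForm_apply, map_smul]
    simp [div_eq_inv_mul]
  have hFz : extD D.b y = wedge (D.ℓ y) z := by
    refine hD.metric.ext_form hy fun X Y ↦ ?_
    have h3 := hs.twoForm_eq hanti hperp X Y
    have h4 : wedge (D.ℓ y) z = fun i j ↦ D.ℓ y i * z j - z i * D.ℓ y j := rfl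
    rw [h4, app₂_sub, app₂_tmul, app₂_tmul]
    change _ = ip h _ _ * ip h _ _ - ip h _ _ * ip h _ _
    rw [hzX, hzX]
    exact h3
  have hDu : appForm h (cov₁ D.g D.u y) (D.x y) (D.ℓ y)
      = -(ipBil h (D.ℓ y) (D.x y) * ipBil h (D.u y) (D.u y)) := by
    have e1 : ∀ i, ip h (cov₁ D.g D.u y i) (D.ℓ y) = -ip h (D.T y i) (D.u y) := by
      intro i
      have := hD.metric.ip_cov_of_const hD.u_smooth hD.smooth_l (c := 0)
        (fun z hz ↦ hD.ip_u_l hz) hy i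
      have e2 := hs.symm (D.u y) (cov₁ D.g D.ℓ y i)
      simp only [ipBil_apply] at e2
      change ip h _ _ + ip h _ _ = 0 at this
      change _ = -ip h (cov₁ D.g D.ℓ y i) _
      linarith
    rw [appForm_apply, app₂_eq_sum]
    simp only [e1, mul_neg, Finset.sum_neg_distrib]
    rw [← app₂_eq_sum, hD.T_eq hy (h1 y hy) (h2 y hy), app₂_add, app₂_tmul, app₂_tmul]
    have e3 := hs.symm (D.ℓ y) (D.u y)
    simp only [ipBil_apply] at e3
    rw [e3, hul]
    simp [ipBil_apply]
  have hlz := hs.db_l_x star hul hDu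
  rw [← hF, hanti] at hlz
  have hll : ip h (D.ℓ y) (D.ℓ y) = 0 := hs.ll
  have hzl := hs.symm (D.ℓ y) z
  simp only [ipBil_apply] at hzl
  rw [Fields.phi5, hFz, ipForm_wedge, ← hh, hll, hzl, hzX (D.ℓ y)] at h5
  have h6 : appForm h (extD D.b y) (D.x y) (D.ℓ y) = 0 := by
    have : appForm h (extD D.b y) (D.x y) (D.ℓ y) / D.lx y = 0 :=
      mul_self_eq_zero.1 (by linarith)
    simpa [hlx] using this
  rw [h6, neg_zero] at hlz
  have h7 := (mul_eq_zero.1 hlz.symm).resolve_right hs.lx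
  have h8 := hD.ip_u_u h1 h2 hy
  simp only [ipBil_apply] at h7
  rw [← hh] at h8
  rw [h8] at h7
  change 2 * D.lam y + _ = 0 at h7
  linarith

/-- If `λ = 0`, then `∇ℓ = w ⊗ ℓ`. -/
theorem u_eq_zero (h5 : D.phi5 y = 0) (h0 : D.lam y = 0) : D.u y = 0 := by
  have hs := hD.screen y hy
  have h6 := hD.lam_eq h1 h2 hy h5
  have huu : ipBil (D.inv y) (D.u y) (D.u y) = 0 := by
    rw [ipBil_apply, hD.ip_u_u h1 h2 hy]; linarith
  have hul : ipBil (D.inv y) (D.ℓ y) (D.u y) = 0 := by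
    rw [hs.symm]; exact hD.ip_u_l hy
  have hux : ipBil (D.inv y) (D.u y) (D.x y) = 0 := by
    rw [ipBil_apply, ip_u, Fields.lx]
    have : ip (D.inv y) (D.ℓ y) (D.x y) ≠ 0 := hs.lx
    field_simp
    simp
  rw [hs.eq_smul_of_null hul huu, hux]
  simp

end Family

end IsAdapted

/-! ### Segre types -/

section Segre

variable {V : Type*} [AddCommGroup V] [Module ℝ V]

/-- A Jordan chain of length two together with two independent vectors of the kernel. -/
theorem hasSegreType_211 (A : V →ₗ[ℝ] V) {p x e₂ e₃ : V} (hV : Module.finrank ℝ V = 4)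
    (hli : ∀ a b c d : ℝ, a • p + b • x + c • e₂ + d • e₃ = 0 → a = 0 ∧ b = 0 ∧ c = 0 ∧ d = 0)
    (hp : A p = 0) (hx : A x = p) (h2 : A e₂ = 0) (h3 : A e₃ = 0) :
    HasSegreType A ![2, 1, 1] := by
  let f : (Σ j : Fin 3, Fin (![2, 1, 1] j)) → V := fun s ↦ ![![p, x], ![e₂, e₂], ![e₃, e₃]] s.1
    ⟨s.2.val, lt_of_lt_of_le s.2.isLt (by rcases s with ⟨j, k⟩; fin_cases j <;> simp)⟩
  have hf : LinearIndependent ℝ f := by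
    rw [Fintype.linearIndependent_iff]
    intro c hc
    rw [Fintype.sum_sigma, Fin.sum_univ_three] at hc
    erw [Fin.sum_univ_two, Fin.sum_univ_one, Fin.sum_univ_one] at hc
    obtain ⟨h0, h1, h2, h3⟩ := hli _ _ _ _ hc
    rintro ⟨j, k⟩
    fin_cases j <;> fin_cases k <;> assumption
  have hcard : Fintype.card (Σ j : Fin 3, Fin (![2, 1, 1] j)) = Module.finrank ℝ V := by
    rw [hV]; rfl
  have : Nonempty (Σ j : Fin 3, Fin (![2, 1, 1] j)) := ⟨⟨0, ⟨0, by simp⟩⟩⟩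
  refine ⟨0, basisOfLinearIndependentOfCardEqFinrank hf hcard, fun j k ↦ ?_⟩
  simp only [coe_basisOfLinearIndependentOfCardEqFinrank, zero_smul, zero_add]
  fin_cases j <;> fin_cases k
  · exact hp
  · exact hx
  · exact h2
  · exact h3

/-- A Jordan chain of length three together with an independent vector of the kernel. -/
theorem hasSegreType_31 (A : V →ₗ[ℝ] V) {p r x s : V} (hV : Module.finrank ℝ V = 4)
    (hli : ∀ a b c d : ℝ, a • p + b • r + c • x + d • s = 0 → a = 0 ∧ b = 0 ∧ c = 0 ∧ d = 0)
    (hp : A p = 0) (hr : A r = p) (hx : A x = r) (hs : A s = 0) :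
    HasSegreType A ![3, 1] := by
  let f : (Σ j : Fin 2, Fin (![3, 1] j)) → V := fun t ↦ ![![p, r, x], ![s, s, s]] t.1
    ⟨t.2.val, lt_of_lt_of_le t.2.isLt (by rcases t with ⟨j, k⟩; fin_cases j <;> simp)⟩
  have hf : LinearIndependent ℝ f := by
    rw [Fintype.linearIndependent_iff]
    intro c hc
    rw [Fintype.sum_sigma, Fin.sum_univ_two] at hc
    erw [Fin.sum_univ_three, Fin.sum_univ_one] at hc
    obtain ⟨h0, h1, h2, h3⟩ := hli _ _ _ _ hc
    rintro ⟨j, k⟩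
    fin_cases j <;> fin_cases k <;> assumption
  have hcard : Fintype.card (Σ j : Fin 2, Fin (![3, 1] j)) = Module.finrank ℝ V := by
    rw [hV]; rfl
  have : Nonempty (Σ j : Fin 2, Fin (![3, 1] j)) := ⟨⟨0, ⟨0, by simp⟩⟩⟩
  refine ⟨0, basisOfLinearIndependentOfCardEqFinrank hf hcard, fun j k ↦ ?_⟩
  simp only [coe_basisOfLinearIndependentOfCardEqFinrank, zero_smul, zero_add]
  fin_cases j <;> fin_cases k
  · exact hp
  · exact hr
  · exact hx
  · exact hs

end Segre

namespace IsAdapted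

variable {D : Fields} {U : Set Pt} {e₂ e₃ : Pt → Fin 4 → ℝ} (hD : IsAdapted D U e₂ e₃)
include hD

section Point

variable {y : Pt} (hy : y ∈ U) {q : Fin 4 → ℝ} (hq : Q D.g y = symProd (D.ℓ y) q)
  (hlq : ip (D.inv y) (D.ℓ y) q = 0)

omit hD hq in
theorem ip_q (X : Fin 4 → ℝ) : ip (D.inv y) (D.q y) X =
    (ip (D.inv y) (app (D.inv y) (Q D.g y) (D.x y)) X
      - app₂ (D.inv y) (Q D.g y) (D.x y) (D.x y) / (2 * D.lx y) * ip (D.inv y) (D.ℓ y) X)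
        / D.lx y := by
  have : D.q y = fun j ↦ (1 / D.lx y) * (app (D.inv y) (Q D.g y) (D.x y) j
    - app₂ (D.inv y) (Q D.g y) (D.x y) (D.x y) / (2 * D.lx y) * D.ℓ y j) := rfl
  rw [this, ip_lin_comb]
  ring

include hy hq hlq

/-- A symmetrized product of `ℓ` with an orthogonal vector is traceless, so `Ric = 2 Q`. -/
theorem ricci_eq : ricci D.g y = fun i j ↦ 2 * symProd (D.ℓ y) q i j := by
  have hQ : ∀ i j, ricci D.g y i j
      = 2 * symProd (D.ℓ y) q i j + scalarCurv D.g y / 6 * D.g y i j := by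
    intro i j
    rw [← hq, Q]; ring
  have htr : ∑ i, ∑ j, gInv D.g y i j * D.g y i j = 4 := by
    have : ∀ i, ∑ j, gInv D.g y i j * D.g y i j = 1 := by
      intro i
      have := hD.metric.inv_mul_g hy i i
      simp only [if_true] at this
      rw [← this]
      exact Finset.sum_congr rfl fun j _ ↦ by rw [hD.metric.symm]
    simp [this]
  have hsp : ∑ i, ∑ j, gInv D.g y i j * symProd (D.ℓ y) q i j = 0 := by
    have h1 : ∑ i, ∑ j, gInv D.g y i j * symProd (D.ℓ y) q i j
        = ip (D.inv y) (D.ℓ y) q + ip (D.inv y) q (D.ℓ y) := by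
      simp only [ip, raise, symProd, Finset.mul_sum, ← Finset.sum_add_distrib]
      refine Finset.sum_congr rfl fun i _ ↦ Finset.sum_congr rfl fun j _ ↦ ?_
      change gInv D.g y i j * _ = _ * (gInv D.g y i j * _) + _ * (gInv D.g y i j * _)
      ring
    rw [h1, ip_comm (hD.inv_symm y) q, hlq, add_zero]
  have hr : scalarCurv D.g y = 0 := by
    have h1 : scalarCurv D.g y = ∑ i, ∑ j, (2 * (gInv D.g y i j * symProd (D.ℓ y) q i j)
        + scalarCurv D.g y / 6 * (gInv D.g y i j * D.g y i j)) := by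
      conv_lhs => rw [scalarCurv]
      exact Finset.sum_congr rfl fun i _ ↦ Finset.sum_congr rfl fun j _ ↦ by rw [hQ]; ring
    simp only [Finset.sum_add_distrib, ← Finset.mul_sum, hsp, htr] at h1
    linarith
  funext i j
  rw [hQ, hr]; ring

theorem ricciOp_raise (X : Fin 4 → ℝ) : ricciOp D.g y (raise (D.inv y) X) =
    raise (D.inv y) ((2 * ip (D.inv y) q X) • D.ℓ y + (2 * ip (D.inv y) (D.ℓ y) X) • q) := by
  have h1 : ∀ v, raise (D.inv y) v = (D.inv y).mulVec v := fun v ↦ rfl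
  rw [ricciOp, Matrix.toLin'_apply, ← Matrix.mulVec_mulVec, ← Fields.inv, ← h1]
  congr 1
  funext i
  rw [hD.ricci_eq hy hq hlq]
  simp only [Matrix.mulVec, dotProduct, Matrix.of_apply, symProd, ip, Pi.smul_apply, Pi.add_apply,
    smul_eq_mul, Finset.sum_mul, ← Finset.sum_add_distrib, Finset.mul_sum]
  exact Finset.sum_congr rfl fun _ _ ↦ by ring

omit hq hlq in
theorem raise_injective : Function.Injective (raise (D.inv y)) := by
  have h1 : (Matrix.of (D.g y)).det ≠ 0 := hD.metric.det_ne y hy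
  have h2 : IsUnit (D.inv y) := by
    rw [Matrix.isUnit_iff_isUnit_det]
    exact Matrix.isUnit_nonsing_inv_det _ (Ne.isUnit h1)
  exact Matrix.mulVec_injective_of_isUnit h2

omit hq hlq in
theorem raise_comb_eq_zero {a b c d : ℝ} {p r s t : Fin 4 → ℝ}
    (h : a • raise (D.inv y) p + b • raise (D.inv y) r + c • raise (D.inv y) s
      + d • raise (D.inv y) t = 0) : a • p + b • r + c • s + d • t = 0 := by
  apply hD.raise_injective hy
  simp only [raise_add, raise_smul]
  rw [h]
  ext i; simp [raise]

omit hq hlq in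
theorem l_ne_zero : D.ℓ y ≠ 0 := by
  intro h
  have := (hD.screen y hy).lx
  rw [h] at this
  simp at this

/-- For `q` null the Ricci operator is a nonzero multiple of `ℓ ⊗ ℓ`. -/
theorem segre_211 (hq0 : q ≠ 0) (hqq : ip (D.inv y) q q = 0) :
    HasSegreType (ricciOp D.g y) ![2, 1, 1] := by
  have hs := hD.screen y hy
  have hA := hD.ricciOp_raise hy hq hlq
  have hlx : ip (D.inv y) (D.ℓ y) (D.x y) ≠ 0 := hs.lx
  have hqe := hs.eq_smul_of_null hlq hqq
  set c := ipBil (D.inv y) q (D.x y) / ipBil (D.inv y) (D.ℓ y) (D.x y) with hc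
  have hc0 : c ≠ 0 := by
    intro h; rw [h, zero_smul] at hqe; exact hq0 hqe
  have hA' : ∀ X, ricciOp D.g y (raise (D.inv y) X) =
      raise (D.inv y) ((4 * c * ip (D.inv y) (D.ℓ y) X) • D.ℓ y) := by
    intro X
    rw [hA, hqe]
    congr 1
    rw [← ipBil_apply, ← ipBil_apply, map_smul, LinearMap.smul_apply, smul_eq_mul]
    module
  have hzero : raise (D.inv y) ((0 : ℝ) • D.ℓ y) = 0 := by rw [raise_smul, zero_smul]
  have hll : ip (D.inv y) (D.ℓ y) (D.ℓ y) = 0 := hs.ll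
  have hl2 : ip (D.inv y) (D.ℓ y) (e₂ y) = 0 := hs.l2
  have hl3 : ip (D.inv y) (D.ℓ y) (e₃ y) = 0 := hs.l3
  refine hasSegreType_211 _ (p := raise (D.inv y) ((4 * c * ip (D.inv y) (D.ℓ y) (D.x y)) • D.ℓ y))
    (x := raise (D.inv y) (D.x y)) (e₂ := raise (D.inv y) (e₂ y)) (e₃ := raise (D.inv y) (e₃ y))
    (by simp) ?_ ?_ (hA' _) ?_ ?_
  · intro a b c' d h
    have h0 := hD.raise_comb_eq_zero hy h
    have hb : b = 0 := by
      have := congrArg (ipBil (D.inv y) (D.ℓ y)) h0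
      simpa [hs.ll, hs.l2, hs.l3, hs.lx] using this
    rw [hb] at h0
    have hc' : c' = 0 := by
      have := congrArg (ipBil (D.inv y) (e₂ y)) h0
      simpa [hs.symm (e₂ y) (D.ℓ y), hs.l2, hs.e22, hs.e23] using this
    have hd : d = 0 := by
      have := congrArg (ipBil (D.inv y) (e₃ y)) h0
      simpa [hs.symm (e₃ y) (D.ℓ y), hs.symm (e₃ y) (e₂ y), hs.l3, hs.e33, hs.e23] using this
    rw [hc', hd] at h0
    refine ⟨?_, hb, hc', hd⟩
    simpa [hc0, hlx, hD.l_ne_zero hy] using h0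
  · rw [hA', ← ipBil_apply (D.inv y) (D.ℓ y) (_ • _), map_smul, ipBil_apply, hll]
    simpa using hzero
  · rw [hA', hl2]; simpa using hzero
  · rw [hA', hl3]; simpa using hzero

/-- For `q` spacelike the Ricci operator `A` has the Jordan chain `A² x, A x, x`. -/
theorem segre_31 (hqq : 0 < ip (D.inv y) q q) : HasSegreType (ricciOp D.g y) ![3, 1] := by
  have hs := hD.screen y hy
  have hA := hD.ricciOp_raise hy hq hlq
  have hlx : ip (D.inv y) (D.ℓ y) (D.x y) ≠ 0 := hs.lx
  have hll : ip (D.inv y) (D.ℓ y) (D.ℓ y) = 0 := hs.ll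
  have hql : ip (D.inv y) q (D.ℓ y) = 0 := by rw [ip_comm (hD.inv_symm y), hlq]
  -- the rotation of the screen part of `q` by a right angle
  set s : Fin 4 → ℝ := (-ipBil (D.inv y) (e₃ y) q) • e₂ y + ipBil (D.inv y) (e₂ y) q • e₃ y with hsd
  have hls : ipBil (D.inv y) (D.ℓ y) s = 0 := by simp [hsd, hs.l2, hs.l3]
  have hs2 : ipBil (D.inv y) (e₂ y) s = -ipBil (D.inv y) (e₃ y) q := by
    simp [hsd, hs.e22, hs.e23]
  have hs3 : ipBil (D.inv y) (e₃ y) s = ipBil (D.inv y) (e₂ y) q := by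
    simp [hsd, hs.e33, hs.e23, hs.symm (e₃ y) (e₂ y)]
  have hqs : ipBil (D.inv y) q s = 0 := by
    rw [hs.inner_eq hlq hls, hs2, hs3]; ring
  have hss : ipBil (D.inv y) s s = ipBil (D.inv y) q q := by
    rw [hs.inner_eq hls hls, hs.inner_eq hlq hlq, hs2, hs3]; ring
  have hne : ip (D.inv y) q q ≠ 0 := hqq.ne'
  set r : Fin 4 → ℝ := (2 * ip (D.inv y) q (D.x y)) • D.ℓ y
    + (2 * ip (D.inv y) (D.ℓ y) (D.x y)) • q with hr
  have hlr : ipBil (D.inv y) (D.ℓ y) r = 0 := by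
    simp [hr, map_add, map_smul, hs.ll, ipBil_apply _ (D.ℓ y) q, hlq]
  have hqr : ipBil (D.inv y) q r = 2 * ip (D.inv y) (D.ℓ y) (D.x y) * ip (D.inv y) q q := by
    rw [hr, map_add, map_smul, map_smul, ipBil_apply _ q (D.ℓ y), hql]
    simp [ipBil_apply]
  refine hasSegreType_31 _
    (p := raise (D.inv y) ((2 * ip (D.inv y) q r) • D.ℓ y + (2 * ip (D.inv y) (D.ℓ y) r) • q))
    (r := raise (D.inv y) r) (x := raise (D.inv y) (D.x y)) (s := raise (D.inv y) s)
    (by simp) ?_ ?_ (hA _) (hA _) ?_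
  · intro a b c d h
    have h0 := hD.raise_comb_eq_zero hy h
    rw [show ip (D.inv y) (D.ℓ y) r = 0 from hlr, mul_zero, zero_smul, add_zero,
      show ip (D.inv y) q r = _ from hqr] at h0
    have hc : c = 0 := by
      have := congrArg (ipBil (D.inv y) (D.ℓ y)) h0
      simpa [hs.ll, hlr, hls, hs.lx] using this
    rw [hc] at h0
    have hb : b = 0 := by
      have := congrArg (ipBil (D.inv y) q) h0
      simpa [hs.symm q (D.ℓ y), ipBil_apply _ (D.ℓ y) q, hlq, hqr, hqs, hlx, hne] using this
    rw [hb] at h0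
    have hd : d = 0 := by
      have := congrArg (ipBil (D.inv y) s) h0
      simpa [hs.symm s (D.ℓ y), hls, hss, ipBil_apply _ q q, hne] using this
    rw [hd] at h0
    refine ⟨?_, hb, hc, hd⟩
    simpa [hlx, hne, hD.l_ne_zero hy] using h0
  · have h4 : ∀ a : ℝ, ip (D.inv y) q (a • D.ℓ y) = 0 ∧ ip (D.inv y) (D.ℓ y) (a • D.ℓ y) = 0 := by
      intro a
      simp only [← ipBil_apply, map_smul]
      simp [ipBil_apply, hql, hll]
    rw [hA, show ip (D.inv y) (D.ℓ y) r = 0 from hlr, mul_zero, zero_smul, add_zero, (h4 _).1,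
      (h4 _).2]
    ext i; simp [raise]
  · rw [hA, show ip (D.inv y) q s = 0 from hqs, show ip (D.inv y) (D.ℓ y) s = 0 from hls]
    ext i; simp [raise]

end Point

section Family

variable (h1 : ∀ y ∈ U, D.phi1 y = 0) (h2 : ∀ y ∈ U, D.phi2 y = 0)
  (h5 : ∀ y ∈ U, D.phi5 y = 0) {V : Set Pt} (hV : IsOpen V) (hVU : V ⊆ U)
  (h0 : ∀ y ∈ V, D.lam y = 0)
include h1 h2 h5 hV hVU h0

/-- On an open set where `λ` vanishes, `Q = ℓ ⊗ q + q ⊗ ℓ` with `q` orthogonal to `ℓ`. -/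
theorem Q_eq_symProd {y : Pt} (hy : y ∈ V) :
    Q D.g y = symProd (D.ℓ y) (D.q y) ∧ ip (D.inv y) (D.ℓ y) (D.q y) = 0 := by
  have hyU := hVU hy
  have hs := hD.screen y hyU
  have hlx : ip (D.inv y) (D.ℓ y) (D.x y) ≠ 0 := hs.lx
  have hlx' : D.lx y ≠ 0 := hs.lx
  have hu : D.u y = 0 := hD.u_eq_zero h1 h2 hyU (h5 y hyU) (h0 y hy)
  have hcu : cov₁ D.g D.u y = 0 := by
    have hz : ∀ z ∈ V, D.u z = 0 := fun z hz ↦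
      hD.u_eq_zero h1 h2 (hVU hz) (h5 z (hVU hz)) (h0 z hz)
    funext i j
    simp only [cov₁, hu]
    rw [pd_congr hV (f' := fun _ ↦ 0) (fun z hz' ↦ congrFun (hz z hz') j) hy, pd_const]
    simp
  have hDu : appForm (D.inv y) (cov₁ D.g D.u y) = 0 := by
    ext X Y; simp [hcu, appForm_apply, app₂, app]
  have hl0 : appForm (D.inv y) (Q D.g y) (D.ℓ y) (D.x y) = 0 := by
    have := h0 y hy
    rw [Fields.lam] at this
    exact (div_eq_zero_iff.1 this).resolve_right hlx'
  have hqX : ∀ X, ip (D.inv y) (D.q y) X = (appForm (D.inv y) (Q D.g y) (D.x y) X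
      - appForm (D.inv y) (Q D.g y) (D.x y) (D.x y) / (2 * D.lx y) * ip (D.inv y) (D.ℓ y) X)
        / D.lx y := by
    intro X
    rw [ip_q, ip_comm (hD.inv_symm y) (app _ _ _), ← app₂_eq_ip (hD.inv_symm y),
      hD.Q_form_symm hyU (D.x y) X]
    rfl
  have key := hs.Q_eq (hD.Q_form_symm hyU) (hD.ricci_identity_forms h1 h2 hyU) hu hDu hl0
  constructor
  · refine hD.metric.ext_form hyU fun X Y ↦ ?_
    have h3 : symProd (D.ℓ y) (D.q y) = fun i j ↦ D.ℓ y i * D.q y j + D.q y i * D.ℓ y j := rfl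
    rw [h3, app₂_add, app₂_tmul, app₂_tmul]
    change _ = ip (D.inv y) _ _ * ip (D.inv y) _ _ + ip (D.inv y) _ _ * ip (D.inv y) _ _
    rw [hqX, hqX]
    exact key X Y
  · have hll : ip (D.inv y) (D.ℓ y) (D.ℓ y) = 0 := hs.ll
    rw [ip_comm (hD.inv_symm y), hqX, hll, hD.Q_form_symm hyU, hl0]
    simp

theorem exists_q : ∃ q : Pt → Fin 4 → ℝ, ContDiffOn ℝ ∞ q V ∧ ∀ y ∈ V,
    (∀ i j, Q D.g y i j = symProd (D.ℓ y) (q y) i j) ∧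
    ip (D.inv y) (D.ℓ y) (q y) = 0 ∧
    0 ≤ ip (D.inv y) (q y) (q y) ∧
    (q y = 0 → Q D.g y = 0 ∧ ricci D.g y = 0) ∧
    (q y ≠ 0 → ip (D.inv y) (q y) (q y) = 0 → HasSegreType (ricciOp D.g y) ![2, 1, 1]) ∧
    (0 < ip (D.inv y) (q y) (q y) → HasSegreType (ricciOp D.g y) ![3, 1]) := by
  refine ⟨D.q, contDiffOn_pi.2 fun i ↦ (hD.q_smooth i).mono hVU, fun y hy ↦ ?_⟩
  obtain ⟨hQ, hlq⟩ := hD.Q_eq_symProd h1 h2 h5 hV hVU h0 hy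
  have hyU := hVU hy
  refine ⟨fun i j ↦ by rw [hQ], hlq, ?_, ?_, hD.segre_211 hyU hQ hlq, hD.segre_31 hyU hQ hlq⟩
  · have := (hD.screen y hyU).inner_eq hlq hlq
    rw [ipBil_apply] at this
    rw [this]
    nlinarith [sq_nonneg (ipBil (D.inv y) (e₂ y) (D.q y)), sq_nonneg (ipBil (D.inv y) (e₃ y) (D.q y))]
  · intro hq
    rw [hD.ricci_eq hyU hQ hlq, hQ, hq]
    exact ⟨by funext i j; simp [symProd], by funext i j; simp [symProd]⟩

end Family

end IsAdapted

/-! ### Frames adapted to a null 2-form -/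

section Lorentz

variable {V : Type*} [AddCommGroup V] [Module ℝ V] {γ : LinearMap.BilinForm ℝ V}

theorem IsScreen.shift {ℓ e₂ e₃ x : V} (hs : IsScreen γ ℓ e₂ e₃ x) (a b : ℝ) :
    IsScreen γ ℓ (e₂ + a • ℓ) (e₃ + b • ℓ) x where
  symm := hs.symm
  ll := hs.ll
  l2 := by simp [hs.l2, hs.ll]
  l3 := by simp [hs.l3, hs.ll]
  e22 := by simp [hs.e22, hs.l2, hs.ll, hs.symm e₂ ℓ]
  e33 := by simp [hs.e33, hs.l3, hs.ll, hs.symm e₃ ℓ]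
  e23 := by simp [hs.e23, hs.l2, hs.l3, hs.ll, hs.symm e₂ ℓ]
  lx := hs.lx
  span X h1 h2 h3 := hs.span X h1 (by simpa [h1] using h2) (by simpa [h1] using h3)

/-- An orthonormal frame is a basis. -/
theorem IsOrthonormalFrame.exists_basis {F : Fin 4 → V} (hF : IsOrthonormalFrame γ F)
    (hV : Module.finrank ℝ V = 4) : ∃ b : Module.Basis (Fin 4) ℝ V, ⇑b = F := by
  have hli : LinearIndependent ℝ F := by
    rw [Fintype.linearIndependent_iff]
    intro c hc i
    have h1 := congrArg (fun v ↦ γ v (F i)) hc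
    simp only [map_sum, map_smul, LinearMap.sum_apply, LinearMap.smul_apply, hF _ i, smul_eq_mul,
      map_zero, LinearMap.zero_apply] at h1
    fin_cases i <;> simpa [Fin.sum_univ_four] using h1
  exact ⟨basisOfLinearIndependentOfCardEqFinrank hli (by simp [hV]), by simp⟩

theorem inner_frame {b : Module.Basis (Fin 4) ℝ V} (hb : IsOrthonormalFrame γ b) (X Y : V) :
    γ X Y = -(b.repr X 0 * b.repr Y 0) + b.repr X 1 * b.repr Y 1 + b.repr X 2 * b.repr Y 2
      + b.repr X 3 * b.repr Y 3 := by
  conv_lhs => rw [← b.sum_repr X, ← b.sum_repr Y]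
  simp only [Fin.sum_univ_four, map_add, map_smul, LinearMap.add_apply, LinearMap.smul_apply, hb _ _,
    smul_eq_mul]
  simp
  ring

/-- A nonzero vector orthogonal to a timelike vector is spacelike. -/
theorem spacelike_of_perp {b : Module.Basis (Fin 4) ℝ V} (hb : IsOrthonormalFrame γ b) {T v : V}
    (hT : γ T T < 0) (hTv : γ T v = 0) (hv : v ≠ 0) : 0 < γ v v := by
  rw [inner_frame hb] at hT hTv ⊢
  by_contra hneg
  set t := b.repr T
  set w := b.repr v with hw
  -- Cauchy–Schwarz for the spatial parts
  have hcs : (t 0 * w 0) ^ 2 ≤ (t 1 ^ 2 + t 2 ^ 2 + t 3 ^ 2) * (w 1 ^ 2 + w 2 ^ 2 + w 3 ^ 2) := by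
    have : t 0 * w 0 = t 1 * w 1 + t 2 * w 2 + t 3 * w 3 := by linarith
    rw [this]
    nlinarith [sq_nonneg (t 1 * w 2 - t 2 * w 1), sq_nonneg (t 1 * w 3 - t 3 * w 1),
      sq_nonneg (t 2 * w 3 - t 3 * w 2)]
  have h1 : w 1 ^ 2 + w 2 ^ 2 + w 3 ^ 2 ≤ w 0 ^ 2 := by nlinarith
  have h2 : 0 < t 0 ^ 2 - (t 1 ^ 2 + t 2 ^ 2 + t 3 ^ 2) := by nlinarith
  have h3 : (t 0 ^ 2 - (t 1 ^ 2 + t 2 ^ 2 + t 3 ^ 2)) * w 0 ^ 2 ≤ 0 := by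
    nlinarith [mul_le_mul_of_nonneg_left h1 (by positivity : 0 ≤ t 1 ^ 2 + t 2 ^ 2 + t 3 ^ 2)]
  have h4 : w 0 ^ 2 = 0 := by
    have := nonpos_of_mul_nonpos_right h3 h2
    exact le_antisymm this (sq_nonneg _)
  have hz : ∀ i, w i = 0 := by
    intro i
    have h0 : w i ^ 2 = 0 := by
      fin_cases i <;> simp only [Fin.zero_eta, Fin.mk_one, Fin.reduceFinMk] <;>
        nlinarith [sq_nonneg (w 1), sq_nonneg (w 2), sq_nonneg (w 3)]
    exact pow_eq_zero_iff two_ne_zero |>.1 h0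
  apply hv
  rw [← b.sum_repr v]
  exact Finset.sum_eq_zero fun i _ ↦ by rw [← hw, hz, zero_smul]

/-- A null vector `ℓ` and a unit spacelike vector orthogonal to it extend to an orthonormal
frame `E` with `ℓ` proportional to `E₀ + E₁`. -/
theorem exists_null_frame (hsymm : ∀ X Y, γ X Y = γ Y X) (hV : Module.finrank ℝ V = 4)
    {F : Fin 4 → V} (hF : IsOrthonormalFrame γ F) {ℓ e₂ t : V} (hll : γ ℓ ℓ = 0)
    (hlt : γ ℓ t < 0) (htt : γ t t < 0) (h22 : γ e₂ e₂ = 1) (hl2 : γ ℓ e₂ = 0) :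
    ∃ (E : Fin 4 → V) (κ : ℝ), IsOrthonormalFrame γ E ∧ 0 < κ ∧ ℓ = κ • (E 0 + E 1) ∧ E 2 = e₂ := by
  obtain ⟨b, rfl⟩ := hF.exists_basis hV
  set t' := t - γ t e₂ • e₂ with ht'
  have h1 : γ t' t' < 0 := by
    have : γ t' t' = γ t t - γ t e₂ ^ 2 := by
      simp [ht', h22, hsymm e₂ t]; ring
    nlinarith [sq_nonneg (γ t e₂)]
  have h2 : γ t' e₂ = 0 := by simp [ht', h22]
  have h3 : γ ℓ t' = γ ℓ t := by simp [ht', hl2]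
  set n := Real.sqrt (-γ t' t') with hn
  have hn0 : 0 < n := Real.sqrt_pos.2 (by linarith)
  have hnn : n * n = -γ t' t' := Real.mul_self_sqrt (by linarith)
  set E₀ := n⁻¹ • t' with hE₀
  have h00 : γ E₀ E₀ = -1 := by
    have : γ t' t' = -(n * n) := by linarith
    simp [hE₀, this]; field_simp
  have h02 : γ E₀ e₂ = 0 := by simp [hE₀, h2]
  set κ := -γ ℓ E₀ with hκ
  have hκ0 : 0 < κ := by
    simp only [hκ, hE₀, map_smul, h3, smul_eq_mul]
    have := mul_pos (inv_pos.2 hn0) (neg_pos.2 hlt)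
    linarith
  have hlE : γ ℓ E₀ = -κ := by simp [hκ]
  set E₁ := κ⁻¹ • ℓ - E₀ with hE₁
  have h11 : γ E₁ E₁ = 1 := by
    simp [hE₁, hll, h00, hsymm E₀ ℓ, hlE]; field_simp; ring
  have h01 : γ E₀ E₁ = 0 := by
    simp [hE₁, h00, hsymm E₀ ℓ, hlE]; field_simp; simp
  have h12 : γ E₁ e₂ = 0 := by simp [hE₁, hl2, h02]
  -- a unit vector orthogonal to the three vectors found so far
  obtain ⟨v, hv, hv0⟩ : ∃ v : V, v ∈ LinearMap.ker (LinearMap.pi ![γ E₀, γ E₁, γ e₂]) ∧ v ≠ 0 := by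
    have : FiniteDimensional ℝ V := Module.finite_of_finrank_pos (by rw [hV]; norm_num)
    exact (Submodule.ne_bot_iff _).1 (LinearMap.ker_ne_bot_of_finrank_lt (by simp [hV]))
  rw [LinearMap.mem_ker] at hv
  have hv1 : γ E₀ v = 0 := congrFun hv 0
  have hv2 : γ E₁ v = 0 := congrFun hv 1
  have hv3 : γ e₂ v = 0 := congrFun hv 2
  have hvv := spacelike_of_perp hF (by rw [h00]; norm_num) hv1 hv0
  set m := Real.sqrt (γ v v) with hm
  have hm0 : 0 < m := Real.sqrt_pos.2 hvv
  have hmm : γ v v = m * m := (Real.mul_self_sqrt hvv.le).symm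
  refine ⟨![E₀, E₁, e₂, m⁻¹ • v], κ, ?_, hκ0, ?_, rfl⟩
  · intro i j
    fin_cases i <;> fin_cases j <;>
      simp [h00, h01, h02, h11, h12, h22, hv1, hv2, hv3, hsymm E₁ E₀, hsymm e₂ E₀, hsymm e₂ E₁,
        hsymm v E₀, hsymm v E₁, hsymm v e₂, hmm]
    field_simp
  · simp [hE₁, smul_smul, hκ0.ne']

/-- A null vector and a unit spacelike vector orthogonal to it are completed to a screen, so
that the dual of `ℓ ∧ e₂` is `ℓ ∧ e₃`. -/
theorem exists_screen (hsymm : ∀ X Y, γ X Y = γ Y X) (hV : Module.finrank ℝ V = 4)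
    {F : Fin 4 → V} (hF : IsOrthonormalFrame γ F) {ℓ e₂ t x : V} (hll : γ ℓ ℓ = 0)
    (hlt : γ ℓ t < 0) (htt : γ t t < 0) (h22 : γ e₂ e₂ = 1) (hl2 : γ ℓ e₂ = 0) (hxx : γ x x < 0)
    (vol : V [⋀^Fin 4]→ₗ[ℝ] ℝ)
    (hvol : ∀ v : Fin 4 → V, IsOrthonormalFrame γ v → vol v = 1 ∨ vol v = -1) :
    ∃ e₃ : V, IsScreen γ ℓ e₂ e₃ x ∧
      ∀ X Y, vol ![X, Y, ℓ, e₂] = γ ℓ X * γ e₃ Y - γ e₃ X * γ ℓ Y := by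
  obtain ⟨E, κ, hE, hκ, hℓ, rfl⟩ := exists_null_frame hsymm hV hF hll hlt htt h22 hl2
  obtain ⟨b, rfl⟩ := hE.exists_basis hV
  have hv2 : vol b * vol b = 1 := by rcases hvol _ hE with h | h <;> rw [h] <;> norm_num
  have hin := inner_frame hE
  have hl : ∀ X, γ ℓ X = κ * (b.repr X 1 - b.repr X 0) := by
    intro X; rw [hin, hℓ]; simp; ring
  have h2 : ∀ X, γ (b 2) X = b.repr X 2 := by intro X; rw [hin]; simp
  have h3 : ∀ X, γ (b 3) X = b.repr X 3 := by intro X; rw [hin]; simp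
  refine ⟨(-vol b) • b 3, ⟨hsymm, hll, hl2, ?_, h22, ?_, ?_, ?_, ?_⟩, ?_⟩
  · rw [map_smul, hl]; simp
  · simp [h3, hv2]
  · simp [h2]
  · intro h
    have hl0 : ℓ ≠ 0 := by rintro rfl; simp at hlt
    exact (spacelike_of_perp hE hxx (by rw [hsymm, h]) hl0).ne' hll
  · intro X k1 k2 k3
    rw [hl] at k1
    rw [h2] at k2
    have hvb : vol b ≠ 0 := by intro h; rw [h] at hv2; norm_num at hv2
    rw [map_smul, LinearMap.smul_apply, h3, smul_eq_mul, neg_mul, neg_eq_zero] at k3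
    have k3' := (mul_eq_zero.1 k3).resolve_left hvb
    have k1' : b.repr X 1 = b.repr X 0 := by
      have := (mul_eq_zero.1 k1).resolve_left hκ.ne'; linarith
    refine ⟨b.repr X 0 / κ, ?_⟩
    conv_lhs => rw [← b.sum_repr X]
    rw [Fin.sum_univ_four, k2, k3', k1', hℓ, smul_smul, div_mul_cancel₀ _ hκ.ne']
    simp
  · intro X Y
    have hdet : vol ![X, Y, ℓ, b 2] = vol b * b.det ![X, Y, ℓ, b 2] := by
      conv_lhs => rw [vol.eq_smul_basis_det b]
      rfl
    rw [hdet, hl, hl, map_smul, LinearMap.smul_apply, LinearMap.smul_apply, h3, h3,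
      Module.Basis.det_apply, hℓ]
    simp [Matrix.det_succ_row_zero, Fin.sum_univ_succ, Module.Basis.toMatrix_apply, Fin.succAbove]
    ring

end Lorentz

/-! ### Components with respect to a basis -/

section Gram

variable {V : Type*} [AddCommGroup V] [Module ℝ V] {γ : LinearMap.BilinForm ℝ V}
  (hsymm : ∀ X Y, γ X Y = γ Y X) (B : Module.Basis (Fin 4) ℝ V)

theorem gram_det_ne_zero {F : Fin 4 → V} (hF : IsOrthonormalFrame γ F) :
    (Matrix.of fun i j ↦ γ (B i) (B j)).det ≠ 0 := by
  intro h0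
  set P : Matrix (Fin 4) (Fin 4) ℝ := Matrix.of fun i j ↦ B.repr (F i) j with hP
  have h1 : P * (Matrix.of fun i j ↦ γ (B i) (B j)) * P.transpose
      = Matrix.diagonal ![-1, 1, 1, 1] := by
    ext i j
    have : γ (F i) (F j) = ∑ l, (∑ k, B.repr (F i) k * γ (B k) (B l)) * B.repr (F j) l := by
      conv_lhs => rw [← B.sum_repr (F i), ← B.sum_repr (F j)]
      simp only [map_sum, LinearMap.sum_apply, map_smul, LinearMap.smul_apply, smul_eq_mul,
        Finset.sum_mul]
      exact Finset.sum_congr rfl fun _ _ ↦ by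
        rw [Finset.mul_sum]; exact Finset.sum_congr rfl fun _ _ ↦ by ring
    simp only [Matrix.mul_apply, Matrix.transpose_apply, hP, Matrix.of_apply]
    rw [← this, hF i j]
    fin_cases i <;> fin_cases j <;> simp
  have h2 := congrArg Matrix.det h1
  rw [Matrix.det_mul, Matrix.det_mul, h0, Matrix.det_diagonal] at h2
  simp [Fin.prod_univ_succ] at h2

variable (hdet : (Matrix.of fun i j ↦ γ (B i) (B j)).det ≠ 0)
include hsymm hdet

/-- Raising the index of the covariant components `γ(X, B_i)` gives the coordinates of `X`. -/
theorem raise_gram (X : V) :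
    raise (Matrix.of fun i j ↦ γ (B i) (B j))⁻¹ (fun i ↦ γ X (B i)) = B.repr X := by
  have h1 : (fun i ↦ γ X (B i)) = (Matrix.of fun i j ↦ γ (B i) (B j)).mulVec (B.repr X) := by
    funext i
    have h0 := congrArg (γ (B i)) (B.sum_repr X)
    simp only [map_sum, map_smul, smul_eq_mul] at h0
    rw [hsymm, ← h0]
    exact Finset.sum_congr rfl fun _ _ ↦ mul_comm _ _
  have h2 : ∀ (h : Matrix (Fin 4) (Fin 4) ℝ) v, raise h v = h.mulVec v := fun _ _ ↦ rfl
  rw [h2, h1, Matrix.mulVec_mulVec, Matrix.nonsing_inv_mul _ (Ne.isUnit hdet), Matrix.one_mulVec]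

theorem ip_gram (X Y : V) :
    ip (Matrix.of fun i j ↦ γ (B i) (B j))⁻¹ (fun i ↦ γ X (B i)) (fun i ↦ γ Y (B i)) = γ X Y := by
  rw [ip, raise_gram hsymm B hdet]
  have h0 := congrArg (γ X) (B.sum_repr Y)
  simp only [map_sum, map_smul, smul_eq_mul] at h0
  rw [← h0]
  exact Finset.sum_congr rfl fun _ _ ↦ mul_comm _ _

theorem exists_gram (v : Fin 4 → ℝ) : ∃ X : V, v = fun i ↦ γ X (B i) := by
  set G := Matrix.of fun i j ↦ γ (B i) (B j) with hG
  refine ⟨∑ j, (G⁻¹.mulVec v) j • B j, ?_⟩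
  have h1 : G.mulVec (G⁻¹.mulVec v) = v := by
    rw [Matrix.mulVec_mulVec, Matrix.mul_nonsing_inv _ (Ne.isUnit hdet), Matrix.one_mulVec]
  funext i
  conv_lhs => rw [← h1]
  rw [hsymm]
  simp only [map_sum, map_smul, smul_eq_mul, Matrix.mulVec, dotProduct, hG, Matrix.of_apply]
  exact Finset.sum_congr rfl fun _ _ ↦ mul_comm _ _

theorem IsScreen.gram {ℓ e₂ e₃ x : V} (hs : IsScreen γ ℓ e₂ e₃ x) :
    IsScreen (ipBil (Matrix.of fun i j ↦ γ (B i) (B j))⁻¹) (fun i ↦ γ ℓ (B i)) (fun i ↦ γ e₂ (B i))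
      (fun i ↦ γ e₃ (B i)) (fun i ↦ γ x (B i)) := by
  have hip := ip_gram hsymm B hdet
  refine ⟨?_, ?_, ?_, ?_, ?_, ?_, ?_, ?_, ?_⟩
  · intro v w
    obtain ⟨X, rfl⟩ := exists_gram hsymm B hdet v
    obtain ⟨Y, rfl⟩ := exists_gram hsymm B hdet w
    rw [ipBil_apply, ipBil_apply, hip, hip, hsymm]
  · rw [ipBil_apply, hip, hs.ll]
  · rw [ipBil_apply, hip, hs.l2]
  · rw [ipBil_apply, hip, hs.l3]
  · rw [ipBil_apply, hip, hs.e22]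
  · rw [ipBil_apply, hip, hs.e33]
  · rw [ipBil_apply, hip, hs.e23]
  · rw [ipBil_apply, hip]; exact hs.lx
  · intro v h1 h2 h3
    obtain ⟨X, rfl⟩ := exists_gram hsymm B hdet v
    rw [ipBil_apply, hip] at h1 h2 h3
    obtain ⟨c, rfl⟩ := hs.span X h1 h2 h3
    exact ⟨c, by funext i; simp⟩

omit hsymm hdet in
theorem vol_expand (vol : V [⋀^Fin 4]→ₗ[ℝ] ℝ) (X Y Z W : V) :
    vol ![X, Y, Z, W] = ∑ k, ∑ l, vol ![X, Y, B k, B l] * (B.repr Z k * B.repr W l) := by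
  have h3 : ∀ Z W, ![X, Y, Z, W] = Function.update ![X, Y, Z, 0] 3 W := by
    intro Z W; ext i; fin_cases i <;> rfl
  have h2 : ∀ Z W, ![X, Y, Z, W] = Function.update ![X, Y, 0, W] 2 Z := by
    intro Z W; ext i; fin_cases i <;> rfl
  conv_lhs => rw [← B.sum_repr Z, h2, vol.map_update_sum]
  refine Finset.sum_congr rfl fun k _ ↦ ?_
  rw [vol.map_update_smul, ← h2]
  conv_lhs => rw [← B.sum_repr W, h3, vol.map_update_sum]
  rw [Finset.smul_sum]
  refine Finset.sum_congr rfl fun l _ ↦ ?_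
  rw [vol.map_update_smul, ← h3]
  simp only [smul_eq_mul]
  ring

/-- The Hodge dual of `ℓ ∧ e₂` is the contraction of the volume form with `ℓ` and `e₂`. -/
theorem hodge_gram (vol : V [⋀^Fin 4]→ₗ[ℝ] ℝ) (ℓ e₂ : V) (i j : Fin 4) :
    hodge (Matrix.of fun i j ↦ γ (B i) (B j))⁻¹
      (fun i j k l ↦ vol ![B i, B j, B k, B l])
      (wedge (fun i ↦ γ ℓ (B i)) (fun i ↦ γ e₂ (B i))) i j = vol ![B i, B j, ℓ, e₂] := by
  have hr := raise_gram hsymm B hdet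
  set h := (Matrix.of fun i j ↦ γ (B i) (B j))⁻¹ with hh
  have h1 : ∀ k l, ∑ m, ∑ n, vol ![B i, B j, B k, B l] * h k m * h l n
      * wedge (fun i ↦ γ ℓ (B i)) (fun i ↦ γ e₂ (B i)) m n
      = vol ![B i, B j, B k, B l] * (B.repr ℓ k * B.repr e₂ l)
        - vol ![B i, B j, B k, B l] * (B.repr e₂ k * B.repr ℓ l) := by
    intro k l
    rw [← hr ℓ, ← hr e₂]
    simp only [raise]
    rw [Finset.sum_mul_sum, Finset.sum_mul_sum]
    simp only [Finset.mul_sum, ← Finset.sum_sub_distrib, wedge]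
    exact Finset.sum_congr rfl fun _ _ ↦ Finset.sum_congr rfl fun _ _ ↦ by ring
  have hswap : vol ![B i, B j, e₂, ℓ] = -vol ![B i, B j, ℓ, e₂] := by
    have := vol.map_swap ![B i, B j, ℓ, e₂] (show (2 : Fin 4) ≠ 3 by decide)
    rw [← this]
    congr 1
    ext a; fin_cases a <;> rfl
  rw [hodge]
  simp only [h1, Finset.sum_sub_distrib]
  rw [← vol_expand B vol, ← vol_expand B vol, hswap]
  ring

end Gram

/-! ### Components in a chart -/

section Chart

variable {M : Type*} [TopologicalSpace M] [ChartedSpace Pt M]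

omit [ChartedSpace Pt M] in
theorem region_isOpen {Ω : Set M} (hΩ : IsOpen Ω) (e : OpenPartialHomeomorph M Pt) :
    IsOpen (region Ω e) :=
  e.symm.isOpen_inter_preimage hΩ

/-- The coordinate vectors of a chart form a basis of the tangent space. -/
theorem exists_coordBasis {e : OpenPartialHomeomorph M Pt} (he : e ∈ charts M) {y : Pt}
    (hy : y ∈ e.target) :
    ∃ B : Module.Basis (Fin 4) ℝ (TangentSpace 𝓘(ℝ, Pt) (e.symm y)), ∀ i, B i = coordVec e y i := by
  have hd : e.MDifferentiable 𝓘(ℝ, Pt) 𝓘(ℝ, Pt) :=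
    ⟨(contMDiffOn_of_mem_maximalAtlas he).mdifferentiableOn (by simp),
      (contMDiffOn_symm_of_mem_maximalAtlas he).mdifferentiableOn (by simp)⟩
  have hb := hd.symm.mfderiv_bijective (x := y) hy
  let Φ : Pt ≃ₗ[ℝ] TangentSpace 𝓘(ℝ, Pt) (e.symm y) :=
    LinearEquiv.ofBijective (mfderiv 𝓘(ℝ, Pt) 𝓘(ℝ, Pt) e.symm y).toLinearMap hb
  refine ⟨(EuclideanSpace.basisFun (Fin 4) ℝ).toBasis.map Φ, fun i ↦ ?_⟩
  have hi : (EuclideanSpace.basisFun (Fin 4) ℝ).toBasis i = EuclideanSpace.single i (1 : ℝ) := by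
    simp
  rw [Module.Basis.map_apply, hi]
  rfl

variable (S : Spacetime M) {Ω : Set M}
    {L : ∀ p : M, LinearMap.BilinForm ℝ (TangentSpace 𝓘(ℝ, Pt) p)}
    {ℓ x : ∀ p : M, TangentSpace 𝓘(ℝ, Pt) p}

theorem Spacetime.isMetricOn (hΩ : IsOpen Ω) {e : OpenPartialHomeomorph M Pt} (he : e ∈ charts M) :
    IsMetricOn (comp₂ S.metric e) (region Ω e) where
  isOpen := region_isOpen hΩ e
  smooth i j := (S.metric_smooth e he i j).mono fun _ hy ↦ ⟨hy.1, trivial⟩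
  symm _ _ _ := S.metric_symm _ _ _
  det_ne y hy := by
    obtain ⟨B, hB⟩ := exists_coordBasis he hy.1
    obtain ⟨F, hF⟩ := S.lorentzian (e.symm y)
    have := gram_det_ne_zero B hF
    simp only [hB] at this
    exact this

/-- At each point of a chart the components of `L`, `*L` and `ℓ` are those of a screen. -/
theorem Spacetime.exists_screen_comp (hℓ : S.IsFundamentalVector Ω L ℓ)
    (hx : S.IsTimelikeField Ω x)
    {e : OpenPartialHomeomorph M Pt} (he : e ∈ charts M) {y : Pt} (hy : y ∈ region Ω e) :
    ∃ f₂ f₃ : Fin 4 → ℝ,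
      IsScreen (ipBil ((S.fields L ℓ x e).inv y)) (comp₁ S.metric ℓ e y) f₂ f₃
        (comp₁ S.metric x e y) ∧
      comp₂ L e y = wedge (comp₁ S.metric ℓ e y) f₂ ∧
      (S.fields L ℓ x e).starL y = wedge (comp₁ S.metric ℓ e y) f₃ := by
  obtain ⟨B, hB⟩ := exists_coordBasis he hy.1
  obtain ⟨F, hF⟩ := S.lorentzian (e.symm y)
  obtain ⟨hll, hlt, e₂, h22, hl2, hLe⟩ := hℓ _ hy.2
  have hsymm := S.metric_symm (e.symm y)
  have hV : Module.finrank ℝ (TangentSpace 𝓘(ℝ, Pt) (e.symm y)) = 4 := by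
    rw [Module.finrank_eq_card_basis B]; simp
  obtain ⟨e₃, hs, hvol⟩ := exists_screen hsymm hV hF hll hlt (S.time_timelike _) h22 hl2
    (hx.2 _ hy.2) (S.vol _) (S.vol_frame _)
  have hdet := gram_det_ne_zero B hF
  have hsg := hs.gram hsymm B hdet
  have hhodge := hodge_gram hsymm B hdet (S.vol (e.symm y)) (ℓ (e.symm y)) e₂
  simp only [hB] at hsg hhodge
  have hLw : comp₂ L e y = wedge (comp₁ S.metric ℓ e y)
      (fun i ↦ S.metric (e.symm y) e₂ (coordVec e y i)) := by
    funext i j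
    exact hLe _ _
  refine ⟨_, _, hsg, hLw, ?_⟩
  funext i j
  have h1 : (S.fields L ℓ x e).starL y i j = hodge ((S.fields L ℓ x e).inv y) (comp₄ S.vol e y)
    (comp₂ L e y) i j := rfl
  rw [h1, hLw]
  refine (hhodge i j).trans ?_
  rw [hvol]
  rfl

/-- The components of the fundamental vector are smooth: `ℓ` is recovered from `L` and the time
orientation through `L_{ia} L_j^a = ℓ_i ℓ_j`. -/
theorem Spacetime.smooth_fundamentalVector (hΩ : IsOpen Ω) (hL : S.IsFundamentalForm Ω L)
    (hℓ : S.IsFundamentalVector Ω L ℓ) (hx : S.IsTimelikeField Ω x)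
    {e : OpenPartialHomeomorph M Pt} (he : e ∈ charts M) (i : Fin 4) :
    ContDiffOn ℝ ∞ (fun y ↦ comp₁ S.metric ℓ e y i) (region Ω e) := by
  have hg := S.isMetricOn hΩ he
  have hLs : ∀ i j, ContDiffOn ℝ ∞ (fun y ↦ comp₂ L e y i j) (region Ω e) := hL.1 e he
  set t : Pt → Fin 4 → ℝ := comp₁ S.metric S.time e with ht
  have hts : ∀ j, ContDiffOn ℝ ∞ (fun y ↦ t y j) (region Ω e) := fun j ↦
    (S.time_smooth e he j).mono fun _ hy ↦ ⟨hy.1, trivial⟩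
  set h : Pt → Matrix (Fin 4) (Fin 4) ℝ := gInv (comp₂ S.metric e) with hh
  set N : Pt → Fin 4 → ℝ := fun y ↦ app (h y) (comp₂ L e y) (app (h y) (comp₂ L e y) (t y)) with hN
  have hNs : ∀ j, ContDiffOn ℝ ∞ (fun y ↦ N y j) (region Ω e) :=
    hg.app_smooth hLs (hg.app_smooth hLs hts)
  have hlt : ∀ y ∈ region Ω e, ip (h y) (comp₁ S.metric ℓ e y) (t y) < 0 := by
    intro y hy
    obtain ⟨B, hB⟩ := exists_coordBasis he hy.1
    obtain ⟨F, hF⟩ := S.lorentzian (e.symm y)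
    have h1 := ip_gram (S.metric_symm (e.symm y)) B (gram_det_ne_zero B hF) (ℓ (e.symm y))
      (S.time (e.symm y))
    simp only [hB] at h1
    have h2 := (hℓ _ hy.2).2.1
    rw [← h1] at h2
    exact h2
  have hNl : ∀ y ∈ region Ω e,
      N y = (-ip (h y) (comp₁ S.metric ℓ e y) (t y)) • comp₁ S.metric ℓ e y := by
    intro y hy
    obtain ⟨f₂, f₃, hs, hLw, -⟩ := S.exists_screen_comp hℓ hx he hy
    set l := comp₁ S.metric ℓ e y with hl
    have happ : ∀ v, app (h y) (comp₂ L e y) v = ip (h y) f₂ v • l - ip (h y) l v • f₂ := by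
      intro v
      funext j
      simp only [hLw, app, wedge, ip, Pi.sub_apply, Pi.smul_apply, smul_eq_mul, Finset.sum_mul,
        ← Finset.sum_sub_distrib]
      exact Finset.sum_congr rfl fun _ _ ↦ by ring
    have hll : ipBil (h y) l l = 0 := hs.ll
    have hl2 : ipBil (h y) l f₂ = 0 := hs.l2
    have h2l : ipBil (h y) f₂ l = 0 := by rw [← hl2]; exact hs.symm _ _
    have h22 : ipBil (h y) f₂ f₂ = 1 := hs.e22
    simp only [hN]
    rw [happ (t y), happ]
    simp only [← ipBil_apply, map_sub, map_smul, hll, hl2, h2l, h22, smul_eq_mul]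
    simp
  have hNN : ∀ y ∈ region Ω e, ip (h y) (N y) (t y)
      = -(ip (h y) (comp₁ S.metric ℓ e y) (t y)) ^ 2 := by
    intro y hy
    rw [hNl y hy, ← ipBil_apply, map_smul, LinearMap.smul_apply, smul_eq_mul, ipBil_apply]
    ring
  have hsq : ∀ y ∈ region Ω e, Real.sqrt (-ip (h y) (N y) (t y))
      = -ip (h y) (comp₁ S.metric ℓ e y) (t y) := by
    intro y hy
    rw [hNN y hy, neg_neg, Real.sqrt_sq_eq_abs, abs_of_neg (hlt y hy)]
  have hfin : ContDiffOn ℝ ∞ (fun y ↦ N y i / Real.sqrt (-ip (h y) (N y) (t y))) (region Ω e) := by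
    refine (hNs i).div (((hg.ip_smooth hNs hts).neg).sqrt fun y hy ↦ ?_) fun y hy ↦ ?_
    · have := hlt y hy
      change -ip (h y) (N y) (t y) ≠ 0
      rw [hNN y hy, neg_neg]
      exact pow_ne_zero 2 this.ne
    · rw [hsq y hy]
      have := hlt y hy
      linarith
  refine hfin.congr fun y hy ↦ ?_
  have h1 := hlt y hy
  rw [hsq y hy, hNl y hy, Pi.smul_apply, smul_eq_mul, mul_div_cancel_left₀ _ (by linarith)]

/-- The smooth screen vectors `-L(x)/(ℓ,x)` and `-*L(x)/(ℓ,x)` are adapted to the null 2-form. -/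
theorem Spacetime.isAdapted (hΩ : IsOpen Ω) (hL : S.IsFundamentalForm Ω L)
    (hℓ : S.IsFundamentalVector Ω L ℓ) (hx : S.IsTimelikeField Ω x)
    {e : OpenPartialHomeomorph M Pt} (he : e ∈ charts M) {D : Fields} (hD : D = S.fields L ℓ x e) :
    IsAdapted D (region Ω e) (fun y i ↦ -(app (D.inv y) (D.L y) (D.x y) i / D.lx y))
      (fun y i ↦ -(app (D.inv y) (D.starL y) (D.x y) i / D.lx y)) := by
  subst hD
  have hg := S.isMetricOn hΩ he
  set D := S.fields L ℓ x e with hD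
  have hls := S.smooth_fundamentalVector hΩ hL hℓ hx he
  have hxs : ∀ i, ContDiffOn ℝ ∞ (fun y ↦ D.x y i) (region Ω e) := fun i ↦ hx.1 e he i
  have hLs : ∀ i j, ContDiffOn ℝ ∞ (fun y ↦ D.L y i j) (region Ω e) := hL.1 e he
  have hηs : ∀ i j k l, ContDiffOn ℝ ∞ (fun y ↦ D.η y i j k l) (region Ω e) := fun i j k l ↦
    (S.vol_smooth e he i j k l).mono fun _ hy ↦ ⟨hy.1, trivial⟩
  have hSs : ∀ i j, ContDiffOn ℝ ∞ (fun y ↦ D.starL y i j) (region Ω e) := by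
    intro i j
    refine contDiffOn_const.mul ?_
    refine ContDiffOn.sum fun k _ ↦ ContDiffOn.sum fun l _ ↦ ContDiffOn.sum fun m _ ↦
      ContDiffOn.sum fun n _ ↦ ?_
    exact (((hηs _ _ _ _).mul (hg.inv_smooth _ _)).mul (hg.inv_smooth _ _)).mul (hLs _ _)
  have hlxs : ContDiffOn ℝ ∞ D.lx (region Ω e) := hg.ip_smooth hls hxs
  have hlx : ∀ y ∈ region Ω e, D.lx y ≠ 0 := fun y hy ↦ by
    obtain ⟨f₂, f₃, hs, -, -⟩ := S.exists_screen_comp hℓ hx he hy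
    exact hs.lx
  have happ : ∀ y ∈ region Ω e, ∀ f : Fin 4 → ℝ,
      (fun i ↦ -(app (D.inv y) (wedge (D.ℓ y) f) (D.x y) i / D.lx y))
        = f + (-(ip (D.inv y) f (D.x y) / D.lx y)) • D.ℓ y := by
    intro y hy f
    have h1 : ∀ i, app (D.inv y) (wedge (D.ℓ y) f) (D.x y) i
        = D.ℓ y i * ip (D.inv y) f (D.x y) - f i * D.lx y := by
      intro i
      simp only [app, wedge, ip, Fields.lx, Finset.mul_sum, ← Finset.sum_sub_distrib]
      exact Finset.sum_congr rfl fun _ _ ↦ by ring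
    have := hlx y hy
    funext i
    rw [h1]
    simp only [Pi.add_apply, Pi.smul_apply, smul_eq_mul]
    field_simp
    ring
  have hwedge : ∀ (l f : Fin 4 → ℝ) (c : ℝ), wedge l (f + c • l) = wedge l f := by
    intro l f c; funext i j; simp [wedge]; ring
  refine ⟨hg, hls, hxs, fun i ↦ ((hg.app_smooth hLs hxs i).div hlxs hlx).neg,
    fun i ↦ ((hg.app_smooth hSs hxs i).div hlxs hlx).neg, ?_, ?_, ?_, ?_⟩
  · intro y hy
    obtain ⟨f₂, f₃, hs, h2, h3⟩ := S.exists_screen_comp hℓ hx he hy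
    change D.L y = wedge (D.ℓ y) f₂ at h2
    change D.starL y = wedge (D.ℓ y) f₃ at h3
    rw [h2, h3, happ y hy, happ y hy]
    exact hs.shift _ _
  · intro y hy
    obtain ⟨f₂, f₃, hs, h2, h3⟩ := S.exists_screen_comp hℓ hx he hy
    change D.L y = wedge (D.ℓ y) f₂ at h2
    rw [h2, happ y hy, hwedge]
  · intro y hy
    obtain ⟨f₂, f₃, hs, h2, h3⟩ := S.exists_screen_comp hℓ hx he hy
    change D.starL y = wedge (D.ℓ y) f₃ at h3
    rw [h3, happ y hy, hwedge]
  · exact hL.2.2 e he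

end Chart

end TypeN

end

theorem mainTheorem7 {M : Type*} [TopologicalSpace M] [ChartedSpace TypeN.Pt M]
    [IsManifold 𝓘(ℝ, TypeN.Pt) ∞ M] (S : TypeN.Spacetime M) (Ω : Set M) (hΩ : IsOpen Ω)
    (hN : S.IsTypeN Ω)
    (L : ∀ p : M, LinearMap.BilinForm ℝ (TangentSpace 𝓘(ℝ, TypeN.Pt) p))
    (ℓ x : ∀ p : M, TangentSpace 𝓘(ℝ, TypeN.Pt) p)
    (hL : S.IsFundamentalForm Ω L) (hℓ : S.IsFundamentalVector Ω L ℓ)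
    (hx : S.IsTimelikeField Ω x) (hC5 : S.IsFamilyC5 Ω L ℓ x)
    (e : OpenPartialHomeomorph M TypeN.Pt) (he : e ∈ TypeN.charts M)
    (D : TypeN.Fields) (hD : D = S.fields L ℓ x e) :
    (∀ y ∈ TypeN.region Ω e,
      (∀ i, TypeN.app (D.inv y) (TypeN.Q D.g y) (D.ℓ y) i = D.lam y * D.ℓ y i) ∧
      2 * D.lam y + D.alpha y ^ 2 + D.alphaStar y ^ 2 = 0 ∧
      D.lam y ≤ 0 ∧
      (D.lam y = 0 ↔ D.alpha y = 0 ∧ D.alphaStar y = 0)) ∧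
    ∀ V : Set TypeN.Pt, IsOpen V → V ⊆ TypeN.region Ω e → (∀ y ∈ V, D.lam y = 0) →
      ∃ q : TypeN.Pt → Fin 4 → ℝ, ContDiffOn ℝ ∞ q V ∧ ∀ y ∈ V,
        (∀ i j, TypeN.Q D.g y i j = TypeN.symProd (D.ℓ y) (q y) i j) ∧
        TypeN.ip (D.inv y) (D.ℓ y) (q y) = 0 ∧
        0 ≤ TypeN.ip (D.inv y) (q y) (q y) ∧
        (q y = 0 → TypeN.Q D.g y = 0 ∧ TypeN.ricci D.g y = 0) ∧
        (q y ≠ 0 → TypeN.ip (D.inv y) (q y) (q y) = 0 →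
          TypeN.HasSegreType (TypeN.ricciOp D.g y) ![2, 1, 1]) ∧
        (0 < TypeN.ip (D.inv y) (q y) (q y) →
          TypeN.HasSegreType (TypeN.ricciOp D.g y) ![3, 1]) := by
  have hA := S.isAdapted hΩ hL hℓ hx he hD
  have hphi := hC5 e he
  rw [← hD] at hphi
  have h1 := fun y hy ↦ (hphi y hy).1
  have h2 := fun y hy ↦ (hphi y hy).2.1
  have h5 := fun y hy ↦ (hphi y hy).2.2.2.2
  refine ⟨fun y hy ↦ ?_, fun V hV hVU h0 ↦ hA.exists_q h1 h2 h5 hV hVU h0⟩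
  have hlam := hA.lam_eq h1 h2 hy (h5 y hy)
  refine ⟨hA.app_Q_l h1 h2 hy, hlam, by nlinarith [sq_nonneg (D.alpha y), sq_nonneg (D.alphaStar y)],
    fun h ↦ ?_, fun h ↦ ?_⟩
  · rw [h] at hlam
    constructor <;> refine pow_eq_zero_iff two_ne_zero |>.1 ?_ <;>
      nlinarith [sq_nonneg (D.alpha y), sq_nonneg (D.alphaStar y)]
  · rw [h.1, h.2] at hlam
    linarith
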